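/- **Corollary 2.5.** Let $(\mathcal H,\Delta)$ be a Hopf algebra over $\mathbb C$ with counit $\varepsilon$ and bijective antipode $S$, and let $\mathcal B$ be a unital right $\mathcal H$-module algebra, that is, a unital complex algebra with a right action $\triangleleft$ of $\mathcal H$ such that $(b_1b_2)\triangleleft\omega=(b_1\triangleleft\omega_{(0)})(b_2\triangleleft\omega_{(1)})$ and $1\triangleleft\omega=\varepsilon(\omega)1$ (Sweedler notation, summation understood). For $n\ge 0$ let $C^n=C^n_{\mathcal H}(\mathcal B)$ be the space of linear functionals $f$ on $\mathcal H\otimes\mathcal B^{\otimes(n+1)}$ which are $\mathcal H$-invariant, i.e. $$f\bigl(S^{-1}(\omega_{(0)})\,\eta\,\omega_{(1)}\otimes b_0\triangleleft\omega_{(2)}\otimes\dots\otimes b_n\triangleleft\omega_{(n+2)}\bigr)=\varepsilon(\omega)\,f(\eta\otimes b_0\otimes\dots\otimes b_n)$$ for all $\omega,\eta\in\mathcal H$ and $b_0,\dots,b_n\in\mathcal B$. Put $$(t_nf)(\omega\otimes b_0\otimes\dots\otimes b_n)=f(\omega_{(0)}\otimes b_n\triangleleft\omega_{(1)}\otimes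 b_0\otimes\dots\otimes b_{n-1}),$$ $$(d^n_if)(\omega\otimes b_0\otimes\dots\otimes b_n)=f(\omega\otimes b_0\otimes\dots\otimes b_ib_{i+1}\otimes\dots\otimes b_n)\quad(0\le i<n),\qquad d^n_n=t_nd^n_0,$$ where $d^n_i\colon C^{n-1}\to C^n$, and let $b_n=\sum_{i=0}^n(-1)^id^n_i$, $b'_n=\sum_{i=0}^{n-1}(-1)^id^n_i$, $\lambda_n=(-1)^nt_n$ and $N^n=\sum_{i=0}^n\lambda_n^i$. The equivariant cyclic cohomology $HC^\bullet_{\mathcal H}(\mathcal B)$ is the cohomology of the total complex of the first quadrant bicomplex which has $C^q$ in row $q$ of every column $p\ge0$, vertical differential $b$ in the even columns and $-b'$ in the odd columns, and horizontal differential $1-\lambda$ from even to odd columns and $N$ from odd to even columns. An algebra homomorphism $\varphi\colon\mathcal B\to\mathcal B'$ of right $\mathcal H$-module algebras with $\varphi(x\triangleleft\omega)=\varphi(x)\triangleleft\omega$ induces linear maps $HC^n_{\mathcal H}(\mathcal B')\to HC^n_{\mathcal H}(\mathcal B)$ through $f\mapsto f\circ(\iota\otimes\varphi^{\otimes(\bullet+1)})$,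 where $\iota$ is the identity map of $\mathcal H$. Let $b\in\mathcal B$ be invertible and $\mathcal H$-invariant, i.e. $b\triangleleft\omega=\varepsilon(\omega)b$ for all $\omega\in\mathcal H$. Then the inner automorphism $\mathrm{Ad}\,b\colon x\mapsto bxb^{-1}$ of $\mathcal B$ respects the action of $\mathcal H$, and it induces the identity map on $HC^n_{\mathcal H}(\mathcal B)$ for every $n\ge0$. -/

import Mathlib

set_option linter.unusedSectionVars false

noncomputable section

namespace EquivariantCyclic

open scoped TensorProduct

/-- A unital right module algebra over a complex Hopf algebra `H` : a unital complex algebra `B`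
with a right action `act b ω = b ◁ ω` of `H`, such that
`(b₁ b₂) ◁ ω = (b₁ ◁ ω₍₀₎) (b₂ ◁ ω₍₁₎)` and `1 ◁ ω = ε(ω) 1`. -/
class RightModuleAlgebra (H B : Type*) [Ring H] [HopfAlgebra ℂ H] [Ring B] [Algebra ℂ B] where
  /-- The bilinear map `(b, ω) ↦ b ◁ ω`. -/
  act : B →ₗ[ℂ] H →ₗ[ℂ] B
  act_one : ∀ b : B, act b 1 = b
  act_mul : ∀ (b : B) (ω η : H), act b (ω * η) = act (act b ω) η
  mul_act : ∀ (b₁ b₂ : B) (ω : H), act (b₁ * b₂) ω =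
    TensorProduct.lift ((LinearMap.mul ℂ B).compl₁₂ (act b₁) (act b₂)) (Coalgebra.comul (R := ℂ) ω)
  one_act : ∀ ω : H, act 1 ω = Coalgebra.counit (R := ℂ) ω • (1 : B)

open RightModuleAlgebra

section Sweedler

variable {H : Type*} [Ring H] [HopfAlgebra ℂ H] {M : Type*} [AddCommGroup M] [Module ℂ M]

/-- Sweedler notation: `sweedler β ω = β(ω₍₀₎, ω₍₁₎)` (summation understood). -/
def sweedler (β : H →ₗ[ℂ] H →ₗ[ℂ] M) : H →ₗ[ℂ] M :=
  TensorProduct.lift β ∘ₗ Coalgebra.comul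

theorem sweedler_add (β γ : H →ₗ[ℂ] H →ₗ[ℂ] M) : sweedler (β + γ) = sweedler β + sweedler γ := by
  rw [sweedler, sweedler, sweedler, ← LinearMap.add_comp]
  congr 1
  ext x y
  simp

theorem sweedler_smul (c : ℂ) (β : H →ₗ[ℂ] H →ₗ[ℂ] M) : sweedler (c • β) = c • sweedler β := by
  rw [sweedler, sweedler, ← LinearMap.smul_comp]
  congr 1
  ext x y
  simp

theorem sweedler_map {M' : Type*} [AddCommGroup M'] [Module ℂ M'] (L : M →ₗ[ℂ] M')
    (β : H →ₗ[ℂ] H →ₗ[ℂ] M) (ω : H) : L (sweedler β ω) = sweedler (β.compr₂ L) ω := by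
  have h : L ∘ₗ sweedler β = sweedler (β.compr₂ L) := by
    rw [sweedler, sweedler, ← LinearMap.comp_assoc]
    congr 1
    ext x y
    simp
  exact LinearMap.congr_fun h ω

theorem sweedler_counit_left (L : H →ₗ[ℂ] M) (ω : H) :
    sweedler (LinearMap.smulRight (Coalgebra.counit (R := ℂ) (A := H)) L) ω = L ω := by
  have h : TensorProduct.lift (LinearMap.smulRight (Coalgebra.counit (R := ℂ) (A := H)) L) =
      L ∘ₗ (TensorProduct.lid ℂ H).toLinearMap ∘ₗ
        (Coalgebra.counit (R := ℂ) (A := H)).rTensor H := by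
    ext x y
    simp
  rw [sweedler, h]
  simp

theorem sweedler_counit_right (L : H →ₗ[ℂ] M) (ω : H) :
    sweedler (LinearMap.smulRight (Coalgebra.counit (R := ℂ) (A := H)) L).flip ω = L ω := by
  have h : TensorProduct.lift
      (LinearMap.smulRight (Coalgebra.counit (R := ℂ) (A := H)) L).flip =
      L ∘ₗ (TensorProduct.rid ℂ H).toLinearMap ∘ₗ
        (Coalgebra.counit (R := ℂ) (A := H)).lTensor H := by
    ext x y
    simp
  rw [sweedler, h]
  simp

/-- The inverse `S⁻¹` of a bijective antipode. -/
def antipodeInv (hS : Function.Bijective (HopfAlgebra.antipode ℂ : H →ₗ[ℂ] H)) : H →ₗ[ℂ] H :=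
  (LinearEquiv.ofBijective (HopfAlgebra.antipode ℂ) hS).symm.toLinearMap

/-- The right action of `H` on itself: `adj hS η ω = η ◁ ω = S⁻¹(ω₍₀₎) η ω₍₁₎`. -/
def adj (hS : Function.Bijective (HopfAlgebra.antipode ℂ : H →ₗ[ℂ] H)) (η : H) : H →ₗ[ℂ] H :=
  sweedler (LinearMap.mul ℂ H ∘ₗ LinearMap.mulRight ℂ η ∘ₗ antipodeInv hS)

end Sweedler

/-- The linear functionals on `H ⊗ B^{⊗(n+1)}`, written as functions of `ω ∈ H` and
`b₀, …, bₙ ∈ B` which are linear in every variable: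
`f ω ![b₀, …, bₙ] = f(ω ⊗ b₀ ⊗ ⋯ ⊗ bₙ)`. -/
abbrev Functional (H B : Type*) [Ring H] [HopfAlgebra ℂ H] [Ring B] [Algebra ℂ B] (n : ℕ) :
    Type _ :=
  H →ₗ[ℂ] MultilinearMap ℂ (fun _ : Fin (n + 1) => B) ℂ

section Cochains

variable {H B : Type*} [Ring H] [HopfAlgebra ℂ H] [Ring B] [Algebra ℂ B] [RightModuleAlgebra H B]

/-- The diagonal action on tensors, paired with a functional:
`diagAct m b g ω = g(b₀ ◁ ω₍₀₎, …, b_{m-1} ◁ ω₍ₘ₋₁₎)`, and `diagAct 0 b g ω = ε(ω) g()`. -/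
def diagAct : (m : ℕ) → (Fin m → B) →
    MultilinearMap ℂ (fun _ : Fin m => B) ℂ →ₗ[ℂ] H →ₗ[ℂ] ℂ
  | 0, b =>
    { toFun := fun g => g b • Coalgebra.counit
      map_add' := fun g g' => by simp [add_smul]
      map_smul' := fun c g => by simp [mul_smul] }
  | m + 1, b =>
    { toFun := fun g => sweedler (diagAct m (Fin.tail b) ∘ₗ g.curryLeft ∘ₗ act (b 0))
      map_add' := fun g g' => by
        rw [← sweedler_add]
        congr 1
        ext x y
        simp only [LinearMap.comp_apply, LinearMap.add_apply]
        rw [← LinearMap.add_apply, ← map_add]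
        rfl
      map_smul' := fun c g => by
        rw [RingHom.id_apply, ← sweedler_smul]
        congr 1
        ext x y
        simp only [LinearMap.comp_apply, LinearMap.smul_apply]
        rw [← LinearMap.smul_apply, ← map_smul]
        rfl }

/-- The left action of `H` on functionals:
`(ω ▷ f)(η ⊗ b₀ ⊗ ⋯ ⊗ bₙ) = f(S⁻¹(ω₍₀₎) η ω₍₁₎ ⊗ b₀ ◁ ω₍₂₎ ⊗ ⋯ ⊗ bₙ ◁ ω₍ₙ₊₂₎)`. -/
def leftAct (hS : Function.Bijective (HopfAlgebra.antipode ℂ : H →ₗ[ℂ] H)) {n : ℕ}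
    (ω : H) (f : Functional H B n) (η : H) (b : Fin (n + 1) → B) : ℂ :=
  sweedler (diagAct (n + 1) b ∘ₗ f ∘ₗ adj hS η) ω

/-- The space `Cⁿ_H(B)` of `H`-invariant functionals: those with `ω ▷ f = ε(ω) f`. -/
def invariantCochains (hS : Function.Bijective (HopfAlgebra.antipode ℂ : H →ₗ[ℂ] H)) (n : ℕ) :
    Submodule ℂ (Functional H B n) where
  carrier := {f | ∀ (ω η : H) (b : Fin (n + 1) → B),
    leftAct hS ω f η b = Coalgebra.counit (R := ℂ) ω * f η b}
  zero_mem' := fun ω η b => by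
    have h := sweedler_smul (0 : ℂ) (0 : H →ₗ[ℂ] H →ₗ[ℂ] ℂ)
    rw [zero_smul, zero_smul] at h
    simp [leftAct, h]
  add_mem' := fun {f g} hf hg ω η b => by
    have h : leftAct hS ω (f + g) η b = leftAct hS ω f η b + leftAct hS ω g η b := by
      simp [leftAct, LinearMap.comp_add, LinearMap.add_comp, sweedler_add]
    rw [h, hf, hg]; simp [mul_add]
  smul_mem' := fun c f hf ω η b => by
    have h : leftAct hS ω (c • f) η b = c * leftAct hS ω f η b := by
      simp [leftAct, LinearMap.comp_smul, LinearMap.smul_comp, sweedler_smul]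
    rw [h, hf]; simp; ring

/-- `(tₙ f)(ω ⊗ b₀ ⊗ ⋯ ⊗ bₙ) = f(ω₍₀₎ ⊗ bₙ ◁ ω₍₁₎ ⊗ b₀ ⊗ ⋯ ⊗ bₙ₋₁)` before summation over the
coproduct: the value at `(x, y)` replaces `ω₍₀₎` by `x` and `ω₍₁₎` by `y`. -/
def cyclicPair {n : ℕ} (f : Functional H B n) (x y : H) :
    MultilinearMap ℂ (fun _ : Fin (n + 1) => B) ℂ where
  toFun := fun b => f x (Fin.cons (act (b (Fin.last n)) y) (Fin.init b))
  map_update_add' := by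
    intro inst b k u v
    obtain rfl : inst = instDecidableEqFin _ := Subsingleton.elim _ _
    induction k using Fin.lastCases with
    | last => simp [MultilinearMap.cons_add]
    | cast j =>
      have hne : Fin.last n ≠ j.castSucc := (Fin.castSucc_lt_last j).ne'
      simp only [Function.update_of_ne hne, Fin.init_update_castSucc, Fin.cons_update,
        MultilinearMap.map_update_add]
  map_update_smul' := by
    intro inst b k c u
    obtain rfl : inst = instDecidableEqFin _ := Subsingleton.elim _ _
    induction k using Fin.lastCases with
    | last => simp [MultilinearMap.cons_smul]
    | cast j =>
      have hne : Fin.last n ≠ j.castSucc := (Fin.castSucc_lt_last j).ne'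
      simp only [Function.update_of_ne hne, Fin.init_update_castSucc, Fin.cons_update,
        MultilinearMap.map_update_smul]

/-- The cyclic operator:
`(tₙ f)(ω ⊗ b₀ ⊗ ⋯ ⊗ bₙ) = f(ω₍₀₎ ⊗ bₙ ◁ ω₍₁₎ ⊗ b₀ ⊗ ⋯ ⊗ bₙ₋₁)`. -/
def cyclicOp (n : ℕ) : Functional H B n →ₗ[ℂ] Functional H B n where
  toFun := fun f => sweedler (LinearMap.mk₂ ℂ (cyclicPair f)
    (fun x x' y => by ext b; simp [cyclicPair])
    (fun c x y => by ext b; simp [cyclicPair])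
    (fun x y y' => by ext b; simp [cyclicPair, MultilinearMap.cons_add])
    (fun c x y => by ext b; simp [cyclicPair, MultilinearMap.cons_smul]))
  map_add' := fun f g => by
    rw [← sweedler_add]
    congr 1
  map_smul' := fun c f => by
    rw [RingHom.id_apply, ← sweedler_smul]
    congr 1

theorem contractNth_update {n : ℕ} (i : Fin (n + 1)) (b : Fin (n + 2) → B) (k : Fin (n + 2))
    (u : B) :
    Fin.contractNth i.castSucc (· * ·) (Function.update b k u) =
      Function.update (Fin.contractNth i.castSucc (· * ·) b) (i.predAbove k)
        (if k = i.castSucc then u * b i.succ else if k = i.succ then b i.castSucc * u else u) := by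
  ext j
  have hp : (i.predAbove k : ℕ) = if (i : ℕ) < k then (k : ℕ) - 1 else k := by
    unfold Fin.predAbove
    split_ifs with h1 h2 h2 <;> simp only [Fin.lt_def, Fin.val_castSucc] at h1 <;> simp_all
  simp only [Fin.contractNth, Function.update_apply, Fin.ext_iff, Fin.val_castSucc, Fin.val_succ,
    hp]
  have hi : (i : ℕ) = j → b i.succ = b j.succ ∧ b i.castSucc = b j.castSucc := fun h => by
    obtain rfl : i = j := Fin.ext h
    exact ⟨rfl, rfl⟩
  grind

/-- Multiplication of two neighbouring variables:
`(innerFace i f)(ω ⊗ b₀ ⊗ ⋯ ⊗ bₙ₊₁) = f(ω ⊗ b₀ ⊗ ⋯ ⊗ bᵢ bᵢ₊₁ ⊗ ⋯ ⊗ bₙ₊₁)` for `i ≤ n`. -/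
def innerFace {n : ℕ} (i : Fin (n + 1)) : Functional H B n →ₗ[ℂ] Functional H B (n + 1) where
  toFun := fun f =>
    { toFun := fun ω =>
        { toFun := fun b => f ω (Fin.contractNth i.castSucc (· * ·) b)
          map_update_add' := by
            intro inst b k u v
            obtain rfl : inst = instDecidableEqFin _ := Subsingleton.elim _ _
            simp only [contractNth_update]
            split_ifs <;> simp [add_mul, mul_add]
          map_update_smul' := by
            intro inst b k c u
            obtain rfl : inst = instDecidableEqFin _ := Subsingleton.elim _ _
            simp only [contractNth_update]
            split_ifs <;> simp }
      map_add' := fun x y => by ext b; simp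
      map_smul' := fun c x => by ext b; simp }
  map_add' := fun f g => by ext ω b; simp
  map_smul' := fun c f => by ext ω b; simp

/-- The cofaces `dᵢ : Cⁿ → Cⁿ⁺¹`, `0 ≤ i ≤ n + 1` : multiplication of `bᵢ` and `bᵢ₊₁` for
`i ≤ n`, and `dₙ₊₁ = tₙ₊₁ d₀`. -/
def coface (n : ℕ) (i : Fin (n + 2)) : Functional H B n →ₗ[ℂ] Functional H B (n + 1) :=
  Fin.lastCases (motive := fun _ => Functional H B n →ₗ[ℂ] Functional H B (n + 1))
    (cyclicOp (n + 1) ∘ₗ innerFace 0) innerFace i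

/-- `b : Cⁿ → Cⁿ⁺¹`, the alternating sum of all cofaces. -/
def hochschild (n : ℕ) : Functional H B n →ₗ[ℂ] Functional H B (n + 1) :=
  ∑ i : Fin (n + 2), (-1 : ℂ) ^ (i : ℕ) • coface n i

/-- `b' : Cⁿ → Cⁿ⁺¹`, the alternating sum of all cofaces but the last. -/
def hochschild' (n : ℕ) : Functional H B n →ₗ[ℂ] Functional H B (n + 1) :=
  ∑ i : Fin (n + 1), (-1 : ℂ) ^ (i : ℕ) • coface n i.castSucc

/-- `λₙ = (-1)ⁿ tₙ`. -/
def signedCyclicOp (n : ℕ) : Functional H B n →ₗ[ℂ] Functional H B n :=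
  (-1 : ℂ) ^ n • cyclicOp n

/-- `N = 1 + λₙ + ⋯ + λₙⁿ`. -/
def cyclicNorm (n : ℕ) : Functional H B n →ₗ[ℂ] Functional H B n :=
  ∑ i ∈ Finset.range (n + 1), signedCyclicOp n ^ i

/-- The vertical differential `Cⁿ → Cⁿ⁺¹` in column `p` of the cyclic bicomplex:
`b` in even columns and `-b'` in odd columns. -/
def vertical (p n : ℕ) : Functional H B n →ₗ[ℂ] Functional H B (n + 1) :=
  if Even p then hochschild n else -hochschild' n

/-- The horizontal differential on `Cⁿ` from column `p` to column `p + 1` of the cyclic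
bicomplex: `1 - λ` for even `p` and `N` for odd `p`. -/
def horizontal (p n : ℕ) : Functional H B n →ₗ[ℂ] Functional H B n :=
  if Even p then LinearMap.id - signedCyclicOp n else cyclicNorm n

end Cochains

section Cohomology

variable (H B : Type*) [Ring H] [HopfAlgebra ℂ H] [Ring B] [Algebra ℂ B] [RightModuleAlgebra H B]

/-- Families of functionals (not necessarily invariant) of total degree `n` in the cyclic
bicomplex: the entry with index `q` lies in row `q` and column `n - q`. -/
def TotalFunctional (n : ℕ) : Type _ := (q : Fin (n + 1)) → Functional H B q

instance (n : ℕ) : AddCommGroup (TotalFunctional H B n) :=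
  inferInstanceAs (AddCommGroup ((q : Fin (n + 1)) → Functional H B q))

instance (n : ℕ) : Module ℂ (TotalFunctional H B n) :=
  inferInstanceAs (Module ℂ ((q : Fin (n + 1)) → Functional H B q))

variable {H B}

/-- The entry of a family in row `q`. -/
def entry {n : ℕ} (q : Fin (n + 1)) : TotalFunctional H B n →ₗ[ℂ] Functional H B q where
  toFun := fun z => z q
  map_add' := fun _ _ => rfl
  map_smul' := fun _ _ => rfl

/-- A linear map into families, from its entries. -/
def ofEntries {M : Type*} [AddCommGroup M] [Module ℂ M] {n : ℕ}
    (L : (q : Fin (n + 1)) → M →ₗ[ℂ] Functional H B q) : M →ₗ[ℂ] TotalFunctional H B n where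
  toFun := fun x q => L q x
  map_add' := fun x y => funext fun q => map_add (L q) x y
  map_smul' := fun c x => funext fun q => map_smul (L q) c x

/-- The differential of the total complex. The entry of `totalD n z` in row `q` and column
`n + 1 - q` is the sum of the vertical image of the entry of `z` in row `q - 1` and column
`n + 1 - q`, and of the horizontal image of the entry of `z` in row `q` and column `n - q`. -/
def totalD (n : ℕ) : TotalFunctional H B n →ₗ[ℂ] TotalFunctional H B (n + 1) :=
  ofEntries fun q =>
    (Fin.cases (motive := fun q : Fin (n + 2) => TotalFunctional H B n →ₗ[ℂ] Functional H B q)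
      0 (fun r : Fin (n + 1) => vertical (n - r) r ∘ₗ entry r) q) +
    (if h : (q : ℕ) < n + 1 then
      horizontal (n - q) q ∘ₗ entry ⟨q, h⟩ else 0)

/-- The space of degree `n` of the total complex: families of `H`-invariant functionals. -/
def totalCochains (hS : Function.Bijective (HopfAlgebra.antipode ℂ : H →ₗ[ℂ] H)) (n : ℕ) :
    Submodule ℂ (TotalFunctional H B n) :=
  ⨅ q : Fin (n + 1), (invariantCochains hS (q : ℕ)).comap (entry q)

/-- The cocycles of degree `n` of the total complex. -/
def totalCocycles (hS : Function.Bijective (HopfAlgebra.antipode ℂ : H →ₗ[ℂ] H)) (n : ℕ) :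
    Submodule ℂ (TotalFunctional H B n) :=
  totalCochains hS n ⊓ LinearMap.ker (totalD n)

/-- The coboundaries of degree `n` of the total complex. -/
def totalCoboundaries (hS : Function.Bijective (HopfAlgebra.antipode ℂ : H →ₗ[ℂ] H)) :
    (n : ℕ) → Submodule ℂ (TotalFunctional H B n)
  | 0 => ⊥
  | n + 1 => (totalCochains hS n).map (totalD n)

variable (B) in
/-- The equivariant cyclic cohomology `HCⁿ_H(B)` : the cohomology in degree `n` of the total
complex of the cyclic bicomplex of the spaces `C^q_H(B)`, that is, cocycles modulo coboundaries.
The differential, defined by its formula on all functionals, maps invariant families to invariant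
families and squares to zero on them; hence every coboundary is a cocycle. -/
abbrev HC (hS : Function.Bijective (HopfAlgebra.antipode ℂ : H →ₗ[ℂ] H)) (n : ℕ) : Type _ :=
  totalCocycles (B := B) hS n ⧸ (totalCoboundaries (B := B) hS n).submoduleOf (totalCocycles hS n)

end Cohomology

section Functoriality

variable {H B B' : Type*} [Ring H] [HopfAlgebra ℂ H] [Ring B] [Algebra ℂ B]
  [RightModuleAlgebra H B] [Ring B'] [Algebra ℂ B'] [RightModuleAlgebra H B']

variable (H) in
/-- A map respects the right actions of `H` : `φ(x ◁ ω) = φ(x) ◁ ω`. -/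
def IsEquivariant (φ : B → B') : Prop :=
  ∀ (x : B) (ω : H), φ (act x ω) = act (φ x) ω

variable (H) in
/-- Composition with an algebra homomorphism:
`(φ^* f)(ω ⊗ b₀ ⊗ ⋯ ⊗ bₙ) = f(ω ⊗ φ(b₀) ⊗ ⋯ ⊗ φ(bₙ))`. -/
def pullback (φ : B →ₐ[ℂ] B') (n : ℕ) : Functional H B' n →ₗ[ℂ] Functional H B n :=
  LinearMap.compRight ℂ (MultilinearMap.compLinearMapₗ fun _ => φ.toLinearMap)

theorem pullback_apply (φ : B →ₐ[ℂ] B') (n : ℕ) (f : Functional H B' n) (ω : H)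
    (b : Fin (n + 1) → B) : pullback H φ n f ω b = f ω (fun i => φ (b i)) := rfl

theorem diagAct_compLinearMap {φ : B →ₐ[ℂ] B'} (hφ : IsEquivariant H φ) (m : ℕ)
    (g : MultilinearMap ℂ (fun _ : Fin m => B') ℂ) (b : Fin m → B) :
    diagAct (H := H) m b (g.compLinearMap fun _ => φ.toLinearMap) =
      diagAct m (fun i => φ (b i)) g := by
  induction m with
  | zero =>
    refine congrArg (fun c : ℂ => c • (Coalgebra.counit (R := ℂ) (A := H))) (congrArg g ?_)
    exact Subsingleton.elim _ _
  | succ m ih =>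
    refine congrArg sweedler (LinearMap.ext fun x => ?_)
    have h : (g.compLinearMap fun _ => φ.toLinearMap).curryLeft (act (b 0) x) =
        (g.curryLeft (act (φ (b 0)) x)).compLinearMap fun _ => φ.toLinearMap := by
      refine MultilinearMap.ext fun v => congrArg g ?_
      funext i
      refine Fin.cases ?_ (fun j => rfl) i
      exact hφ (b 0) x
    refine (congrArg (diagAct m (Fin.tail b)) h).trans ?_
    exact ih _ _

theorem pullback_mem {φ : B →ₐ[ℂ] B'} (hφ : IsEquivariant H φ)
    (hS : Function.Bijective (HopfAlgebra.antipode ℂ : H →ₗ[ℂ] H)) {n : ℕ}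
    {f : Functional H B' n} (hf : f ∈ invariantCochains hS n) :
    pullback H φ n f ∈ invariantCochains hS n := by
  intro ω η b
  rw [pullback_apply, ← hf]
  simp only [leftAct]
  congr 1
  congr 1
  ext x y
  exact LinearMap.congr_fun (diagAct_compLinearMap hφ _ (f (adj hS η x)) b) y

theorem pullback_cyclicOp {φ : B →ₐ[ℂ] B'} (hφ : IsEquivariant H φ) (n : ℕ) :
    pullback H φ n ∘ₗ cyclicOp n = cyclicOp n ∘ₗ pullback H φ n := by
  ext f ω b
  have h : pullback H φ n (cyclicOp n f) = cyclicOp n (pullback H φ n f) := by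
    refine LinearMap.ext fun ω => ?_
    let L : MultilinearMap ℂ (fun _ : Fin (n + 1) => B') ℂ →ₗ[ℂ]
        MultilinearMap ℂ (fun _ : Fin (n + 1) => B) ℂ :=
      MultilinearMap.compLinearMapₗ fun _ => φ.toLinearMap
    refine (sweedler_map L _ ω).trans ?_
    refine congrArg (fun β => sweedler β ω) (LinearMap.ext₂ fun x y => ?_)
    refine MultilinearMap.ext fun b => congrArg (f x) ?_
    funext i
    refine Fin.cases ?_ (fun j => rfl) i
    exact (hφ (b (Fin.last n)) y).symm
  rw [LinearMap.comp_apply, h, LinearMap.comp_apply]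

theorem pullback_innerFace (φ : B →ₐ[ℂ] B') {n : ℕ} (i : Fin (n + 1)) :
    pullback H φ (n + 1) ∘ₗ innerFace i = innerFace i ∘ₗ pullback H φ n := by
  ext f ω b
  refine congrArg (f ω) (funext fun j => ?_)
  simp only [Fin.contractNth]
  split_ifs <;> simp

theorem pullback_coface {φ : B →ₐ[ℂ] B'} (hφ : IsEquivariant H φ) (n : ℕ) (i : Fin (n + 2)) :
    pullback H φ (n + 1) ∘ₗ coface n i = coface n i ∘ₗ pullback H φ n := by
  induction i using Fin.lastCases with
  | last =>
    simp only [coface, Fin.lastCases_last]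
    rw [← LinearMap.comp_assoc, pullback_cyclicOp hφ, LinearMap.comp_assoc, pullback_innerFace,
      LinearMap.comp_assoc]
  | cast j => simp only [coface, Fin.lastCases_castSucc, pullback_innerFace]

theorem pullback_vertical {φ : B →ₐ[ℂ] B'} (hφ : IsEquivariant H φ) (p n : ℕ) :
    pullback H φ (n + 1) ∘ₗ vertical p n = vertical p n ∘ₗ pullback H φ n := by
  unfold vertical
  have h := fun (i : Fin (n + 2)) (f : Functional H B' n) =>
    LinearMap.congr_fun (pullback_coface hφ n i) f
  simp only [LinearMap.comp_apply] at h
  split_ifs <;> refine LinearMap.ext fun f => ?_ <;>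
  simp [hochschild, hochschild', map_sum, h]

theorem pullback_horizontal {φ : B →ₐ[ℂ] B'} (hφ : IsEquivariant H φ) (p n : ℕ) :
    pullback H φ n ∘ₗ horizontal p n = horizontal p n ∘ₗ pullback H φ n := by
  have h1 : pullback H φ n ∘ₗ signedCyclicOp n = signedCyclicOp n ∘ₗ pullback H φ n := by
    simp only [signedCyclicOp, LinearMap.comp_smul, LinearMap.smul_comp, pullback_cyclicOp hφ]
  have h2 : ∀ i : ℕ, pullback H φ n ∘ₗ (signedCyclicOp n ^ i) =
      (signedCyclicOp n ^ i) ∘ₗ pullback H φ n := by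
    intro i
    induction i with
    | zero => rfl
    | succ i ih =>
      rw [pow_succ, Module.End.mul_eq_comp, ← LinearMap.comp_assoc, ih, LinearMap.comp_assoc, h1]
      rw [pow_succ, Module.End.mul_eq_comp, LinearMap.comp_assoc]
  unfold horizontal
  split_ifs
  · rw [LinearMap.comp_sub, LinearMap.sub_comp, h1]; rfl
  · refine LinearMap.ext fun f => ?_
    have h := fun (i : ℕ) => LinearMap.congr_fun (h2 i) f
    simp only [LinearMap.comp_apply] at h
    simp [cyclicNorm, map_sum, h]

variable (H) in
/-- The map induced by an algebra homomorphism on the total complex. -/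
def totalPullback (φ : B →ₐ[ℂ] B') (n : ℕ) : TotalFunctional H B' n →ₗ[ℂ] TotalFunctional H B n :=
  ofEntries fun q => pullback H φ (q : ℕ) ∘ₗ entry q

theorem totalPullback_totalD {φ : B →ₐ[ℂ] B'} (hφ : IsEquivariant H φ) (n : ℕ)
    (z : TotalFunctional H B' n) :
    totalPullback H φ (n + 1) (totalD n z) = totalD n (totalPullback H φ n z) := by
  have hv := fun (p m : ℕ) (f : Functional H B' m) =>
    LinearMap.congr_fun (pullback_vertical hφ p m) f
  have hh := fun (p m : ℕ) (f : Functional H B' m) =>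
    LinearMap.congr_fun (pullback_horizontal hφ p m) f
  simp only [LinearMap.comp_apply] at hv hh
  funext q
  change pullback H φ q ((_ + _ : _ →ₗ[ℂ] _) z) = (_ + _ : _ →ₗ[ℂ] _) (totalPullback H φ n z)
  rw [LinearMap.add_apply, LinearMap.add_apply, map_add]
  congr 1
  · induction q using Fin.cases with
    | zero => exact map_zero _
    | succ r => exact hv _ _ _
  · split_ifs
    · exact hh _ _ _
    · exact map_zero _

theorem totalPullback_mem {φ : B →ₐ[ℂ] B'} (hφ : IsEquivariant H φ)
    (hS : Function.Bijective (HopfAlgebra.antipode ℂ : H →ₗ[ℂ] H)) (n : ℕ) :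
    totalCochains hS n ≤ (totalCochains hS n).comap (totalPullback H φ n) := by
  intro z hz
  simp only [totalCochains, Submodule.mem_comap, Submodule.mem_iInf] at hz ⊢
  exact fun q => pullback_mem hφ hS (hz q)

theorem totalPullback_cocycles {φ : B →ₐ[ℂ] B'} (hφ : IsEquivariant H φ)
    (hS : Function.Bijective (HopfAlgebra.antipode ℂ : H →ₗ[ℂ] H)) (n : ℕ) :
    ∀ z ∈ totalCocycles hS n, totalPullback H φ n z ∈ totalCocycles hS n := by
  rintro z ⟨hz, hd⟩
  have hd' : totalD n z = 0 := hd
  refine ⟨totalPullback_mem hφ hS n hz, ?_⟩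
  change totalD n (totalPullback H φ n z) = 0
  rw [← totalPullback_totalD hφ, hd', map_zero]

theorem totalPullback_coboundaries {φ : B →ₐ[ℂ] B'} (hφ : IsEquivariant H φ)
    (hS : Function.Bijective (HopfAlgebra.antipode ℂ : H →ₗ[ℂ] H)) (n : ℕ) :
    ∀ z ∈ totalCoboundaries hS n, totalPullback H φ n z ∈ totalCoboundaries hS n := by
  cases n with
  | zero =>
    intro z hz
    rw [totalCoboundaries, Submodule.mem_bot] at hz ⊢
    rw [hz, map_zero]
  | succ n =>
    rintro _ ⟨w, hw, rfl⟩
    exact ⟨totalPullback H φ n w, totalPullback_mem hφ hS n hw, (totalPullback_totalD hφ n w).symm⟩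

/-- The map `HCⁿ_H(B') → HCⁿ_H(B)` induced by an equivariant algebra homomorphism `B → B'`. -/
def HC.map (hS : Function.Bijective (HopfAlgebra.antipode ℂ : H →ₗ[ℂ] H)) (φ : B →ₐ[ℂ] B')
    (hφ : IsEquivariant H φ) (n : ℕ) : HC B' hS n →ₗ[ℂ] HC B hS n :=
  Submodule.mapQ _ _
    ((totalPullback H φ n).restrict (totalPullback_cocycles hφ hS n))
    (fun z hz => totalPullback_coboundaries hφ hS n z hz)

end Functoriality

section Inner

variable {B : Type*} [Ring B] [Algebra ℂ B]

/-- The inner automorphism `Ad b : x ↦ b x b⁻¹`. -/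
def Ad (b : Bˣ) : B ≃ₐ[ℂ] B where
  toFun := fun x => b * x * ((b⁻¹ : Bˣ) : B)
  invFun := fun x => ((b⁻¹ : Bˣ) : B) * x * b
  left_inv := fun x => by simp [mul_assoc]
  right_inv := fun x => by simp [mul_assoc]
  map_mul' := fun x y => by simp [mul_assoc]
  map_add' := fun x y => by simp [mul_add, add_mul]
  commutes' := fun c => by rw [← Algebra.commutes]; simp [mul_assoc]

theorem Ad_apply (b : Bˣ) (x : B) : Ad b x = b * x * ((b⁻¹ : Bˣ) : B) := rfl

variable {H : Type*} [Ring H] [HopfAlgebra ℂ H] [RightModuleAlgebra H B]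

variable (H) in
/-- An element is `H`-invariant if `b ◁ ω = ε(ω) b` for all `ω`. -/
def IsInvariant (b : B) : Prop :=
  ∀ ω : H, act b ω = Coalgebra.counit (R := ℂ) ω • b

theorem act_mul_of_left {b : B} (hb : IsInvariant H b) (x : B) (ω : H) :
    act (b * x) ω = b * act x ω := by
  rw [mul_act]
  change sweedler _ ω = (LinearMap.mulLeft ℂ b ∘ₗ act x) ω
  rw [← sweedler_counit_left (LinearMap.mulLeft ℂ b ∘ₗ act x)]
  refine congrArg (fun β : H →ₗ[ℂ] H →ₗ[ℂ] B => sweedler β ω) (LinearMap.ext₂ fun u v => ?_)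
  simp [hb u]

theorem act_mul_of_right {b : B} (hb : IsInvariant H b) (x : B) (ω : H) :
    act (x * b) ω = act x ω * b := by
  rw [mul_act]
  change sweedler _ ω = (LinearMap.mulRight ℂ b ∘ₗ act x) ω
  rw [← sweedler_counit_right (LinearMap.mulRight ℂ b ∘ₗ act x)]
  refine congrArg (fun β : H →ₗ[ℂ] H →ₗ[ℂ] B => sweedler β ω) (LinearMap.ext₂ fun u v => ?_)
  simp [hb v]

theorem IsInvariant.inv {b : Bˣ} (hb : IsInvariant H (b : B)) :
    IsInvariant H ((b⁻¹ : Bˣ) : B) := by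
  intro ω
  have h := act_mul_of_left hb ((b⁻¹ : Bˣ) : B) ω
  rw [Units.mul_inv, one_act] at h
  rw [← Units.inv_mul_cancel_left b (act ((b⁻¹ : Bˣ) : B) ω), ← h]
  simp

/-- Conjugation with an invariant invertible element respects the action. -/
theorem Ad_isEquivariant {b : Bˣ} (hb : IsInvariant H (b : B)) :
    IsEquivariant H ((Ad b : B ≃ₐ[ℂ] B) : B →ₐ[ℂ] B) := by
  intro x ω
  change (b : B) * act x ω * ((b⁻¹ : Bˣ) : B) = act ((b : B) * x * ((b⁻¹ : Bˣ) : B)) ω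
  rw [act_mul_of_right hb.inv, act_mul_of_left hb]

end Inner

end EquivariantCyclic
end

set_option linter.unusedSectionVars false

namespace EquivariantCyclic

open scoped TensorProduct
open RightModuleAlgebra

/-! ### Sweedler calculus, and invariance without the antipode. -/

section Sweedler

variable {H : Type*} [Ring H] [HopfAlgebra ℂ H] {M : Type*} [AddCommGroup M] [Module ℂ M]

/-! Write Ad* for the pullback along conjugation with the invariant unit u, and D for the total
differential. Invariance of cochains gives t ^ (n + 1) = 1 (`cyclicOp_pow_succ`), so in
characteristic zero the rows of the bicomplex are exact except in column 0
(`horizontal_rowContraction`). Modulo D of an invariant family, a total cocycle of positive degree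
is therefore one cochain f in column 0 with λf = f and bf = 0 (`residue`, `horizontal_residue`). It
remains to find an operator h on Hochschild cochains which preserves invariance and cyclicity and
satisfies bh + hb = 1 - Ad*; then Ad*f - f = -b(hf), and hf is again cyclic.

To make h cyclic, all positions are treated alike. Between neighbouring variables of a cochain, in
cyclic order, lie gaps; put xᵢ⁻¹ xᵢ into gap i, with xᵢ equal to 1 or u, so that bᵢ becomes xᵢ₋₁ bᵢ
xᵢ⁻¹ (`gapConj`). Give the choice u the weight s and the choice 1 the weight 1 - s. The weighted sum
over all choices is a path of operators from the identity at s = 0 to Ad* at s = 1. Its derivative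
is a sum over the gaps j, and the integral of the j-th term is `gapOp u j`; the coefficients are
Beta integrals.

Four facts carry the argument. The operators `gapOp u j` add up to Ad* - 1 (`sum_gapOp`). A coface
dᵢ multiplies across gap i, where xᵢ⁻¹ xᵢ cancels: hence gap i contributes nothing after dᵢ
(`gapOp_coface_self`), and the other gaps pass through dᵢ (`gapOp_coface`). The cyclic operator
shifts the gaps (`cyclicOp_gapOp`).

The homotopy h inserts 1 into gap j after `gapOp u j` and takes the alternating sum over all gaps
but the last (`conjHomotopy`). The cosimplicial identities then give the homotopy formula
(`conjHomotopy_succ`), and the shift of the gaps gives cyclicity (`signedCyclicOp_conjHomotopy`).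
Invariance of u makes multiplication by u and u⁻¹ commute with the action, so everything stays
within invariant cochains. -/

/-- `sweedler` as a linear map. -/
noncomputable def sweedlerₗ : (H →ₗ[ℂ] H →ₗ[ℂ] M) →ₗ[ℂ] H →ₗ[ℂ] M where
  toFun := sweedler
  map_add' := sweedler_add
  map_smul' := sweedler_smul

@[simp]
theorem sweedlerₗ_apply (β : H →ₗ[ℂ] H →ₗ[ℂ] M) : sweedlerₗ β = sweedler β := rfl

theorem sweedler_congr {β γ : H →ₗ[ℂ] H →ₗ[ℂ] M} (h : ∀ x y, β x y = γ x y) (ω : H) :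
    sweedler β ω = sweedler γ ω := by
  rw [LinearMap.ext₂ h]

theorem comp_sweedler {M' : Type*} [AddCommGroup M'] [Module ℂ M'] (L : M →ₗ[ℂ] M')
    (β : H →ₗ[ℂ] H →ₗ[ℂ] M) : L ∘ₗ sweedler β = sweedler (β.compr₂ L) :=
  LinearMap.ext (sweedler_map L β)

theorem sweedler_repr {ι : Type*} (β : H →ₗ[ℂ] H →ₗ[ℂ] M) {ω : H} (r : Coalgebra.Repr ℂ ω ι) :
    sweedler β ω = ∑ i ∈ r.index, β (r.left i) (r.right i) := by
  simp [sweedler, ← r.eq]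

/-- Coassociativity. -/
theorem sweedler_sweedler (τ : H →ₗ[ℂ] H →ₗ[ℂ] H →ₗ[ℂ] M) (ω : H) :
    sweedler (sweedler τ) ω = sweedler (sweedlerₗ ∘ₗ τ) ω := by
  have h := congrArg (TensorProduct.lift ((TensorProduct.lift.equiv (.id ℂ) H H M).toLinearMap ∘ₗ τ))
    (Coalgebra.coassoc_apply (R := ℂ) ω)
  have h1 : TensorProduct.lift ((TensorProduct.lift.equiv (.id ℂ) H H M).toLinearMap ∘ₗ τ) ∘ₗ
      (TensorProduct.assoc ℂ H H H).toLinearMap ∘ₗ Coalgebra.comul.rTensor H =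
      TensorProduct.lift (sweedler τ) := by
    refine TensorProduct.ext' fun x y => ?_
    have h2 : ∀ t : H ⊗[ℂ] H,
        TensorProduct.lift ((TensorProduct.lift.equiv (.id ℂ) H H M).toLinearMap ∘ₗ τ)
          (TensorProduct.assoc ℂ H H H (t ⊗ₜ y)) = TensorProduct.lift τ t y := by
      intro t
      induction t with
      | zero => simp
      | tmul a b => simp
      | add a b ha hb => simp [TensorProduct.add_tmul, ha, hb]
    simp [sweedler, h2]
  have h3 : TensorProduct.lift ((TensorProduct.lift.equiv (.id ℂ) H H M).toLinearMap ∘ₗ τ) ∘ₗ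
      Coalgebra.comul.lTensor H = TensorProduct.lift (sweedlerₗ ∘ₗ τ) := by
    refine TensorProduct.ext' fun x y => ?_
    simp only [LinearMap.comp_apply, LinearMap.lTensor_tmul, TensorProduct.lift.tmul]
    rfl
  have h4 := LinearMap.congr_fun h1 (Coalgebra.comul ω)
  have h5 := LinearMap.congr_fun h3 (Coalgebra.comul ω)
  simp only [LinearMap.comp_apply, LinearEquiv.coe_coe] at h4 h5
  rw [sweedler, LinearMap.comp_apply, ← h4, h, h5]
  rfl

/-- The coproduct is multiplicative. Only the coproduct of `η` is expanded into a finite sum: what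
remains is a Sweedler sum in `ω`, to which coassociativity still applies. -/
theorem sweedler_mul (β : H →ₗ[ℂ] H →ₗ[ℂ] M) {ι : Type*} {η : H} (r : Coalgebra.Repr ℂ η ι)
    (ω : H) :
    sweedler β (η * ω) = ∑ i ∈ r.index,
      sweedler (β.compl₁₂ (LinearMap.mulLeft ℂ (r.left i)) (LinearMap.mulLeft ℂ (r.right i))) ω := by
  simp only [sweedler_repr _ (Coalgebra.Repr.arbitrary ℂ ω)]
  simp only [sweedler, LinearMap.comp_apply, Bialgebra.comul_mul, ← r.eq,
    ← (Coalgebra.Repr.arbitrary ℂ ω).eq, Finset.sum_mul, Finset.mul_sum, map_sum]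
  rw [Finset.sum_comm]
  simp

theorem sweedler_mul_right (β : H →ₗ[ℂ] H →ₗ[ℂ] M) {ι : Type*} {η : H} (r : Coalgebra.Repr ℂ η ι)
    (ω : H) :
    sweedler β (ω * η) = ∑ i ∈ r.index,
      sweedler (β.compl₁₂ (LinearMap.mulRight ℂ (r.left i)) (LinearMap.mulRight ℂ (r.right i)))
        ω := by
  simp only [sweedler_repr _ (Coalgebra.Repr.arbitrary ℂ ω)]
  simp only [sweedler, LinearMap.comp_apply, Bialgebra.comul_mul, ← r.eq,
    ← (Coalgebra.Repr.arbitrary ℂ ω).eq, Finset.sum_mul, Finset.mul_sum, map_sum]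
  simp

section Antipode

variable (hS : Function.Bijective (HopfAlgebra.antipode ℂ : H →ₗ[ℂ] H))

theorem antipode_antipodeInv (x : H) : HopfAlgebra.antipode ℂ (antipodeInv hS x) = x :=
  (LinearEquiv.ofBijective (HopfAlgebra.antipode ℂ) hS).apply_symm_apply x

/-- Applying S, which reverses products, turns S⁻¹(ω₍₁₎) ω₍₀₎ into S(ω₍₀₎) ω₍₁₎. Note the reversed
order of the legs. -/
theorem sweedler_antipodeInv_mul (ω : H) :
    sweedler ((LinearMap.mul ℂ H).flip.compl₂ (antipodeInv hS)) ω =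
      Coalgebra.counit (R := ℂ) ω • (1 : H) := by
  apply hS.1
  rw [sweedler_repr _ (Coalgebra.Repr.arbitrary ℂ ω), map_smul, HopfAlgebra.antipode_one,
    ← HopfAlgebra.sum_antipode_mul_eq_smul (Coalgebra.Repr.arbitrary ℂ ω), map_sum]
  simp [HopfAlgebra.antipode_mul_antidistrib, antipode_antipodeInv]

theorem sweedler_mul_antipodeInv (ω : H) :
    sweedler ((LinearMap.mul ℂ H).flip ∘ₗ antipodeInv hS) ω =
      Coalgebra.counit (R := ℂ) ω • (1 : H) := by
  apply hS.1
  rw [sweedler_repr _ (Coalgebra.Repr.arbitrary ℂ ω), map_smul, HopfAlgebra.antipode_one,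
    ← HopfAlgebra.sum_mul_antipode_eq_smul (Coalgebra.Repr.arbitrary ℂ ω), map_sum]
  simp [HopfAlgebra.antipode_mul_antidistrib, antipode_antipodeInv]

/-- `diagMul G η ω = G(η ω₍₀₎, ω₍₁₎)`. -/
noncomputable def diagMul (G : H →ₗ[ℂ] H →ₗ[ℂ] M) : H →ₗ[ℂ] H →ₗ[ℂ] M :=
  sweedlerₗ ∘ₗ LinearMap.compRight ℂ G ∘ₗ LinearMap.mul ℂ H

theorem diagMul_apply (G : H →ₗ[ℂ] H →ₗ[ℂ] M) (η : H) :
    diagMul G η = sweedler (G ∘ₗ LinearMap.mulLeft ℂ η) := rfl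

theorem sweedler_comp_adj (G : H →ₗ[ℂ] H →ₗ[ℂ] M) (η ω : H) :
    sweedler (G ∘ₗ adj hS η) ω =
      sweedler (diagMul G ∘ₗ LinearMap.mulRight ℂ η ∘ₗ antipodeInv hS) ω := by
  rw [adj, comp_sweedler, sweedler_sweedler]
  rfl

/-- Invariance under `η ⊗ x ↦ S⁻¹(ω₍₀₎) η ω₍₁₎ ⊗ x ◁ ω₍₂₎` expressed without the antipode. -/
theorem forall_sweedler_comp_adj_iff (G : H →ₗ[ℂ] H →ₗ[ℂ] M) (E : H →ₗ[ℂ] M) :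
    (∀ ω η, sweedler (G ∘ₗ adj hS η) ω = Coalgebra.counit (R := ℂ) ω • E η) ↔
      ∀ ω η, diagMul G η ω = E (ω * η) := by
  constructor
  · intro h ω η
    -- Expand E(ωη) = E(ω₍₀₎ η) ε(ω₍₁₎) and use the hypothesis for ω₍₁₎ at ω₍₀₎ η. This produces
    -- S⁻¹(ω₍₁₎) ω₍₀₎ η in front, which is the value of `μ` and collapses to ε times η.
    let μ : H →ₗ[ℂ] H →ₗ[ℂ] H :=
      ((LinearMap.mul ℂ H).flip ∘ₗ LinearMap.mulRight ℂ η).compl₂ (antipodeInv hS)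
    have hμ : ∀ r, sweedler μ r = Coalgebra.counit (R := ℂ) r • η := by
      intro r
      have := sweedler_map (LinearMap.mulRight ℂ η)
        ((LinearMap.mul ℂ H).flip.compl₂ (antipodeInv hS)) r
      rw [sweedler_antipodeInv_mul] at this
      refine Eq.trans (sweedler_congr (fun x y => ?_) r) (this.symm.trans ?_)
      · simp [μ, mul_assoc]
      · simp
    have h1 : E (ω * η) = sweedler (LinearMap.smulRight (Coalgebra.counit (R := ℂ) (A := H))
        (E ∘ₗ LinearMap.mulRight ℂ η)).flip ω := by
      rw [sweedler_counit_right]; rfl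
    rw [h1, ← sweedler_counit_left (diagMul G η) ω]
    have h2 : sweedler (LinearMap.smulRight (Coalgebra.counit (R := ℂ) (A := H))
        (E ∘ₗ LinearMap.mulRight ℂ η)).flip ω = sweedler (sweedlerₗ ∘ₗ μ.compr₂ (diagMul G)) ω := by
      refine sweedler_congr (fun x y => ?_) ω
      refine Eq.trans ?_ (Eq.trans (h y (x * η)).symm (sweedler_comp_adj hS G (x * η) y))
      simp
    rw [h2, ← sweedler_sweedler]
    refine sweedler_congr (fun x y => ?_) ω
    rw [← comp_sweedler]
    simp [hμ]
  · intro h ω η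
    rw [sweedler_comp_adj]
    -- The hypothesis turns G(S⁻¹(ω₍₀₎) η ω₍₁₎, ω₍₂₎) into E(ω₍₁₎ S⁻¹(ω₍₀₎) η), where the antipode
    -- cancels.
    have h1 := sweedler_map (E ∘ₗ LinearMap.mulRight ℂ η)
        ((LinearMap.mul ℂ H).flip ∘ₗ antipodeInv hS) ω
    rw [sweedler_mul_antipodeInv] at h1
    refine Eq.trans (sweedler_congr (fun x y => ?_) ω) (h1.symm.trans ?_)
    · simp [h, mul_assoc]
    · simp

end Antipode

end Sweedler

/-! ### The diagonal action: equivariant maps, units, products, last variable. -/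

section Diagonal

variable {H B : Type*} [Ring H] [HopfAlgebra ℂ H] [Ring B] [Algebra ℂ B] [RightModuleAlgebra H B]

variable (B) in
/-- `curryLeft` as a linear map. -/
noncomputable def curryLeftₗ (m : ℕ) : MultilinearMap ℂ (fun _ : Fin (m + 1) => B) ℂ →ₗ[ℂ]
    B →ₗ[ℂ] MultilinearMap ℂ (fun _ : Fin m => B) ℂ :=
  (multilinearCurryLeftEquiv ℂ (fun _ : Fin (m + 1) => B) ℂ).toLinearMap

@[simp]
theorem curryLeftₗ_apply {m : ℕ} (g : MultilinearMap ℂ (fun _ : Fin (m + 1) => B) ℂ) (a : B)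
    (b : Fin m → B) : curryLeftₗ B m g a b = g (Fin.cons a b) := rfl

theorem diagAct_succ {m : ℕ} (b : Fin (m + 1) → B)
    (g : MultilinearMap ℂ (fun _ : Fin (m + 1) => B) ℂ) :
    diagAct (H := H) (m + 1) b g =
      sweedler (diagAct m (Fin.tail b) ∘ₗ curryLeftₗ B m g ∘ₗ act (b 0)) := rfl

/-- The maps may differ from slot to slot, as they do for conjugation in the gaps. -/
theorem diagAct_compLinearMap_pi {m : ℕ} {L : Fin m → B →ₗ[ℂ] B}
    (hL : ∀ i, IsEquivariant H (L i))
    (g : MultilinearMap ℂ (fun _ : Fin m => B) ℂ) (b : Fin m → B) :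
    diagAct (H := H) m b (g.compLinearMap L) = diagAct m (fun i => L i (b i)) g := by
  induction m with
  | zero =>
    refine congrArg (fun c : ℂ => c • (Coalgebra.counit (R := ℂ) (A := H))) (congrArg g ?_)
    exact Subsingleton.elim _ _
  | succ m ih =>
    refine congrArg sweedler (LinearMap.ext fun x => ?_)
    have h : (g.compLinearMap L).curryLeft (act (b 0) x) =
        (g.curryLeft (act (L 0 (b 0)) x)).compLinearMap fun i => L i.succ := by
      refine MultilinearMap.ext fun v => congrArg g ?_
      funext i
      refine Fin.cases ?_ (fun j => rfl) i
      exact hL 0 (b 0) x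
    refine (congrArg (diagAct m (Fin.tail b)) h).trans ?_
    exact ih (fun i => hL i.succ) _ _

/-- The leg that acts on 1 becomes a counit and disappears. -/
theorem diagAct_insertNth_one {m : ℕ} (i : Fin (m + 1))
    (g : MultilinearMap ℂ (fun _ : Fin (m + 1) => B) ℂ) (b : Fin m → B) :
    diagAct (H := H) (m + 1) (i.insertNth 1 b) g = diagAct m b (g.curryMid i 1) := by
  have zero : ∀ {m : ℕ} (g : MultilinearMap ℂ (fun _ : Fin (m + 1) => B) ℂ) (b : Fin m → B),
      diagAct (H := H) (m + 1) ((0 : Fin (m + 1)).insertNth 1 b) g =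
        diagAct m b (g.curryMid 0 1) := by
    intro m g b
    refine LinearMap.ext fun ω => ?_
    rw [← sweedler_counit_left (diagAct m b (g.curryMid 0 1)), diagAct_succ]
    refine sweedler_congr (fun x y => ?_) ω
    have h : curryLeftₗ B m g 1 = g.curryMid 0 1 := by
      refine MultilinearMap.ext fun c => ?_
      simp
    simp [one_act, h]
  induction m with
  | zero => rw [Fin.fin_one_eq_zero i]; exact zero g b
  | succ m ih =>
    induction i using Fin.cases with
    | zero => exact zero g b
    | succ i =>
      obtain ⟨a, c, rfl⟩ : ∃ a c, b = Fin.cons a c := ⟨_, _, (Fin.cons_self_tail b).symm⟩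
      rw [Fin.insertNth_succ_cons, diagAct_succ, diagAct_succ]
      refine congrArg sweedler (LinearMap.ext fun x => ?_)
      have h3 : (g.curryMid i.succ 1).curryLeft (act a x) =
          (g.curryLeft (act a x)).curryMid i 1 := by
        refine MultilinearMap.ext fun v => ?_
        exact congrArg g (Fin.insertNth_succ_cons i (1 : B) (act a x) v)
      exact (ih i _ c).trans (congrArg _ h3.symm)

/-- By the module algebra law the leg acting on a product splits in two, and coassociativity
renumbers the legs. Peeling off leading variables reduces to a product in front. -/
theorem diagAct_innerFace {n : ℕ} (i : Fin (n + 1)) (F : Functional H B n) (η : H)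
    (b : Fin (n + 2) → B) :
    diagAct (H := H) (n + 2) b (innerFace i F η) =
      diagAct (n + 1) (Fin.contractNth i.castSucc (· * ·) b) (F η) := by
  have zero : ∀ {n : ℕ} (F : Functional H B n) (b : Fin (n + 2) → B),
      diagAct (H := H) (n + 2) b (innerFace 0 F η) =
      diagAct (n + 1) (Fin.contractNth (Fin.castSucc 0) (· * ·) b) (F η) := by
    intro n F b
    let μ : H →ₗ[ℂ] H →ₗ[ℂ] B := (LinearMap.mul ℂ B).compl₁₂ (act (b 0)) (act (b 1))
    let K := diagAct (H := H) n (Fin.tail (Fin.tail b)) ∘ₗ curryLeftₗ B n (F η)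
    refine LinearMap.ext fun ω => ?_
    have h1 : diagAct (H := H) (n + 2) b (innerFace 0 F η) ω =
        sweedler (sweedlerₗ ∘ₗ μ.compr₂ K) ω := by
      refine sweedler_congr (fun x y => ?_) ω
      refine sweedler_congr (fun u v => ?_) y
      refine congrArg (fun g => diagAct (H := H) n (Fin.tail (Fin.tail b)) g v) ?_
      refine MultilinearMap.ext fun c => congrArg (F η) ?_
      funext j
      refine Fin.cases ?_ (fun j => ?_) j
      · simp [Fin.contractNth]; rfl
      · simp [Fin.contractNth]
    have h2 : diagAct (H := H) (n + 1) (Fin.contractNth (Fin.castSucc 0) (· * ·) b) (F η) ω =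
        sweedler (sweedler (μ.compr₂ K)) ω := by
      rw [← comp_sweedler]
      have h3 : sweedler μ = act (b 0 * b 1) := LinearMap.ext fun p => (mul_act _ _ p).symm
      rw [h3, diagAct_succ]
      rfl
    rw [h1, h2, sweedler_sweedler]
  induction n with
  | zero => rw [Fin.fin_one_eq_zero i]; exact zero F b
  | succ n ih =>
    induction i using Fin.cases with
    | zero => exact zero F b
    | succ i =>
      refine congrArg sweedler (LinearMap.ext fun x => ?_)
      have h1 : Fin.tail (Fin.contractNth i.succ.castSucc (· * ·) b) =
          Fin.contractNth i.castSucc (· * ·) (Fin.tail b) := by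
        funext j
        simp [Fin.contractNth, Fin.tail]
      have h2 : Fin.contractNth i.succ.castSucc (· * ·) b 0 = b 0 := by
        simp [Fin.contractNth]
      let F' : Functional H B n := (curryLeftₗ B (n + 1) ∘ₗ F).flip (act (b 0) x)
      have h3 : (innerFace i.succ F η).curryLeft (act (b 0) x) = innerFace i F' η := by
        refine MultilinearMap.ext fun v => congrArg (F η) ?_
        funext j
        refine Fin.cases ?_ (fun j => ?_) j
        · simp [Fin.contractNth]
        · simp [Fin.contractNth]
      rw [LinearMap.comp_apply, LinearMap.comp_apply, LinearMap.comp_apply, LinearMap.comp_apply,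
        h1, h2]
      exact (congrArg _ h3).trans (ih i F' (Fin.tail b))

/-- The functional `(b₀, …, bₘ) ↦ γ(bₘ)(b₀, …, bₘ₋₁)`. -/
noncomputable def snocMap {m : ℕ} (γ : B →ₗ[ℂ] MultilinearMap ℂ (fun _ : Fin m => B) ℂ) :
    MultilinearMap ℂ (fun _ : Fin (m + 1) => B) ℂ :=
  LinearMap.uncurryMid (Fin.last m) γ

theorem snocMap_apply {m : ℕ} (γ : B →ₗ[ℂ] MultilinearMap ℂ (fun _ : Fin m => B) ℂ)
    (b : Fin (m + 1) → B) : snocMap γ b = γ (b (Fin.last m)) (Fin.init b) := by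
  rw [← Fin.removeNth_last]
  rfl

/-- The recursion for `diagAct` splits off the first variable with the first leg. Here the last
variable is split off with the last leg, as the cyclic operator requires. -/
theorem diagAct_snocMap {m : ℕ} (γ : B →ₗ[ℂ] MultilinearMap ℂ (fun _ : Fin m => B) ℂ)
    (b : Fin (m + 1) → B) (ω : H) :
    diagAct (m + 1) b (snocMap γ) ω =
      sweedler (diagAct m (Fin.init b) ∘ₗ γ ∘ₗ act (b (Fin.last m))).flip ω := by
  induction m generalizing ω with
  | zero =>
    let L : H →ₗ[ℂ] ℂ :=
      { toFun := fun x => γ (act (b 0) x) (Fin.tail b)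
        map_add' := by simp
        map_smul' := by simp }
    have h1 : Fin.tail b = Fin.init b := Subsingleton.elim _ _
    refine (sweedler_congr (fun x y => ?_) ω).trans ((sweedler_counit_right L ω).trans
      ((sweedler_counit_left L ω).symm.trans (sweedler_congr (fun x y => ?_) ω)))
    · refine (mul_comm _ _).trans (congrArg _ ?_)
      refine (snocMap_apply _ _).trans ?_
      refine congrArg (γ _) (Subsingleton.elim _ _)
    · refine (mul_comm _ _).trans ?_
      rw [← h1]
      rfl
  | succ m ih =>
    let κ : H →ₗ[ℂ] H →ₗ[ℂ] MultilinearMap ℂ (fun _ : Fin m => B) ℂ :=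
      (curryLeftₗ B m ∘ₗ γ ∘ₗ act (b (Fin.last (m + 1)))).flip ∘ₗ act (b 0)
    let d : Fin m → B := Fin.init (Fin.tail b)
    let τ : H →ₗ[ℂ] H →ₗ[ℂ] H →ₗ[ℂ] ℂ :=
      LinearMap.lflip.toLinearMap ∘ₗ LinearMap.compRight ℂ (diagAct (H := H) m d) ∘ₗ κ
    have h1 : diagAct (H := H) (m + 2) b (snocMap γ) ω = sweedler (sweedlerₗ ∘ₗ τ) ω := by
      refine sweedler_congr (fun x y => ?_) ω
      have h3 : curryLeftₗ B (m + 1) (snocMap γ) (act (b 0) x) =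
          snocMap ((curryLeftₗ B m ∘ₗ γ).flip (act (b 0) x)) := by
        refine MultilinearMap.ext fun c => ?_
        rw [curryLeftₗ_apply, snocMap_apply, snocMap_apply]
        refine congrArg (γ _) ?_
        funext j
        exact Fin.cases rfl (fun j => rfl) j
      exact (congrArg (fun g => diagAct (m + 1) (Fin.tail b) g y) h3).trans (ih _ (Fin.tail b) y)
    rw [h1, ← sweedler_sweedler]
    refine sweedler_congr (fun p v => ?_) ω
    have h4 := sweedler_map (LinearMap.applyₗ (R := ℂ) (M := H) (M₂ := ℂ) v) τ p
    exact h4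

end Diagonal

/-! ### Cofaces and the cyclic operator preserve invariance. -/

section Invariance

variable {H B : Type*} [Ring H] [HopfAlgebra ℂ H] [Ring B] [Algebra ℂ B] [RightModuleAlgebra H B]

/-- Evaluation of multilinear maps. -/
noncomputable def evalₗ {m : ℕ} (b : Fin m → B) :
    MultilinearMap ℂ (fun _ : Fin m => B) ℂ →ₗ[ℂ] ℂ where
  toFun := fun g => g b
  map_add' := fun _ _ => rfl
  map_smul' := fun _ _ => rfl

@[simp]
theorem evalₗ_apply {m : ℕ} (b : Fin m → B) (g : MultilinearMap ℂ (fun _ : Fin m => B) ℂ) :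
    evalₗ b g = g b := rfl

theorem sweedler_apply_eval {m : ℕ}
    (β : H →ₗ[ℂ] H →ₗ[ℂ] MultilinearMap ℂ (fun _ : Fin m => B) ℂ) (ω : H) (b : Fin m → B) :
    sweedler β ω b = sweedler (β.compr₂ (evalₗ b)) ω :=
  sweedler_map (evalₗ b) β ω

theorem sweedler_apply {M : Type*} [AddCommGroup M] [Module ℂ M]
    (τ : H →ₗ[ℂ] H →ₗ[ℂ] H →ₗ[ℂ] M) (ω v : H) :
    sweedler τ ω v = sweedler (τ.compr₂ (LinearMap.applyₗ v)) ω :=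
  sweedler_map (LinearMap.applyₗ v) τ ω

/-- `cyclicPair` as a bilinear map. -/
noncomputable def cyclicPairₗ {n : ℕ} (f : Functional H B n) :
    H →ₗ[ℂ] H →ₗ[ℂ] MultilinearMap ℂ (fun _ : Fin (n + 1) => B) ℂ :=
  LinearMap.mk₂ ℂ (cyclicPair f)
    (fun x x' y => by ext b; simp [cyclicPair])
    (fun c x y => by ext b; simp [cyclicPair])
    (fun x y y' => by ext b; simp [cyclicPair, MultilinearMap.cons_add])
    (fun c x y => by ext b; simp [cyclicPair, MultilinearMap.cons_smul])

theorem cyclicOp_eq {n : ℕ} (f : Functional H B n) : cyclicOp n f = sweedler (cyclicPairₗ f) := rfl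

theorem cyclicPairₗ_eq_snocMap {n : ℕ} (f : Functional H B n) (u v : H) :
    cyclicPairₗ f u v = snocMap (curryLeftₗ B n (f u) ∘ₗ act.flip v) := by
  refine MultilinearMap.ext fun b => ?_
  rw [snocMap_apply]
  rfl

/-- Without the antipode, stability of the invariant cochains under the operators below reduces to
coassociativity. At η = 1 the condition says that acting on all slots at once gives back f. -/
theorem mem_invariantCochains_iff (hS : Function.Bijective (HopfAlgebra.antipode ℂ : H →ₗ[ℂ] H))
    {n : ℕ} (f : Functional H B n) :
    f ∈ invariantCochains hS n ↔ ∀ (b : Fin (n + 1) → B) (ω η : H),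
      diagMul (diagAct (n + 1) b ∘ₗ f) η ω = f (ω * η) b := by
  have h := fun b : Fin (n + 1) → B =>
    forall_sweedler_comp_adj_iff hS (diagAct (n + 1) b ∘ₗ f) (evalₗ b ∘ₗ f)
  exact ⟨fun hf b => (h b).1 fun ω η => hf ω η b, fun hf ω η b => (h b).2 (hf b) ω η⟩

/-- `consAct d g a ω = diagAct (n + 1) (a, d) g ω` as a multilinear expression. -/
noncomputable def consAct {n : ℕ} (d : Fin n → B) :
    MultilinearMap ℂ (fun _ : Fin (n + 1) => B) ℂ →ₗ[ℂ] B →ₗ[ℂ] H →ₗ[ℂ] ℂ :=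
  LinearMap.mk₂ ℂ (fun g a => diagAct (n + 1) (Fin.cons a d) g)
    (fun _ _ _ => by simp) (fun _ _ _ => by simp)
    (fun g a a' => by
      simp only [diagAct_succ, Fin.tail_cons, Fin.cons_zero, map_add, LinearMap.comp_add,
        sweedler_add])
    (fun c g a => by
      simp only [diagAct_succ, Fin.tail_cons, Fin.cons_zero, map_smul, LinearMap.comp_smul,
        sweedler_smul])

@[simp]
theorem consAct_apply {n : ℕ} (d : Fin n → B)
    (g : MultilinearMap ℂ (fun _ : Fin (n + 1) => B) ℂ) (a : B) :
    consAct (H := H) d g a = diagAct (n + 1) (Fin.cons a d) g := rfl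

/-- Both sides are f(u ⊗ bₙ ◁ (q₍ₙ₊₁₎ e q₍₀₎) ⊗ b₀ ◁ q₍₁₎ ⊗ ⋯ ⊗ bₙ₋₁ ◁ q₍ₙ₎). On the right this is a
diagonal action on the rotated tuple, with the last leg set aside, so that invariance of f can be
applied. -/
theorem sweedler_diagAct_cyclicPair {n : ℕ} (f : Functional H B n) (u e : H) (b : Fin (n + 1) → B)
    (q : H) :
    sweedler (diagAct (n + 1) b ∘ₗ cyclicPairₗ f u ∘ₗ LinearMap.mulLeft ℂ e) q =
      sweedler (consAct (Fin.init b) (f u) ∘ₗ act (b (Fin.last n)) ∘ₗ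
        LinearMap.mulRight ℂ e).flip q := by
  let τ : H →ₗ[ℂ] H →ₗ[ℂ] H →ₗ[ℂ] ℂ :=
    LinearMap.lflip.toLinearMap ∘ₗ
      LinearMap.compRight ℂ (diagAct n (Fin.init b) ∘ₗ curryLeftₗ B n (f u) ∘ₗ
        act (b (Fin.last n))) ∘ₗ (LinearMap.mul ℂ H).flip ∘ₗ LinearMap.mulLeft ℂ e
  have h1 : sweedler (diagAct (n + 1) b ∘ₗ cyclicPairₗ f u ∘ₗ LinearMap.mulLeft ℂ e) q =
      sweedler (sweedlerₗ ∘ₗ τ) q := by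
    refine sweedler_congr (fun x y => ?_) q
    simp only [LinearMap.comp_apply, LinearMap.mulLeft_apply, cyclicPairₗ_eq_snocMap]
    rw [diagAct_snocMap]
    refine sweedler_congr (fun w v => ?_) y
    simp [τ, act_mul]
  rw [h1, ← sweedler_sweedler]
  refine sweedler_congr (fun p v => ?_) q
  rw [sweedler_apply, LinearMap.flip_apply, LinearMap.comp_apply, LinearMap.comp_apply,
    consAct_apply, diagAct_succ]
  refine sweedler_congr (fun x y => ?_) p
  simp [τ, act_mul]

theorem cyclicOp_mem {hS : Function.Bijective (HopfAlgebra.antipode ℂ : H →ₗ[ℂ] H)} {n : ℕ}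
    {f : Functional H B n} (hf : f ∈ invariantCochains hS n) :
    cyclicOp n f ∈ invariantCochains hS n := by
  rw [mem_invariantCochains_iff] at hf ⊢
  intro b ω η
  let r := Coalgebra.Repr.arbitrary ℂ η
  rw [cyclicOp_eq, sweedler_mul_right _ r, diagMul_apply]
  have h1 : (diagAct (H := H) (n + 1) b ∘ₗ sweedler (cyclicPairₗ f)) ∘ₗ LinearMap.mulLeft ℂ η =
      ∑ i ∈ r.index, diagAct (H := H) (n + 1) b ∘ₗ sweedler ((cyclicPairₗ f).compl₁₂
        (LinearMap.mulLeft ℂ (r.left i)) (LinearMap.mulLeft ℂ (r.right i))) := by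
    refine LinearMap.ext fun x => ?_
    simp [sweedler_mul _ r]
  rw [h1, ← sweedlerₗ_apply, map_sum, LinearMap.sum_apply, sum_apply]
  refine Finset.sum_congr rfl fun i _ => ?_
  rw [sweedlerₗ_apply, comp_sweedler, sweedler_sweedler, sweedler_apply_eval]
  -- Coassociativity gathers the legs of ω used by f and its diagonal action into one element p,
  -- leaving the last leg v inside the rotated variable; invariance of f is used for p.
  let τ : H →ₗ[ℂ] H →ₗ[ℂ] H →ₗ[ℂ] ℂ :=
    LinearMap.lflip.toLinearMap ∘ₗ
      LinearMap.lcomp ℂ (H →ₗ[ℂ] ℂ) (act (b (Fin.last n)) ∘ₗ LinearMap.mulRight ℂ (r.right i)) ∘ₗ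
        consAct (Fin.init b) ∘ₗ f ∘ₗ LinearMap.mulLeft ℂ (r.left i)
  have h2 : sweedler (sweedlerₗ ∘ₗ ((cyclicPairₗ f).compl₁₂ (LinearMap.mulLeft ℂ (r.left i))
      (LinearMap.mulLeft ℂ (r.right i))).compr₂ (diagAct (n + 1) b)) ω =
      sweedler (sweedlerₗ ∘ₗ τ) ω := by
    refine sweedler_congr (fun x q => ?_) ω
    exact sweedler_diagAct_cyclicPair f (r.left i * x) (r.right i) b q
  rw [h2, ← sweedler_sweedler]
  refine sweedler_congr (fun p v => ?_) ω
  rw [sweedler_apply]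
  exact hf (Fin.cons (act (b (Fin.last n)) (v * r.right i)) (Fin.init b)) p (r.left i)

theorem innerFace_mem {hS : Function.Bijective (HopfAlgebra.antipode ℂ : H →ₗ[ℂ] H)} {n : ℕ}
    (i : Fin (n + 1)) {f : Functional H B n} (hf : f ∈ invariantCochains hS n) :
    innerFace i f ∈ invariantCochains hS (n + 1) := by
  rw [mem_invariantCochains_iff] at hf ⊢
  intro b ω η
  refine Eq.trans ?_ (hf (Fin.contractNth i.castSucc (· * ·) b) ω η)
  refine sweedler_congr (fun x y => ?_) ω
  exact LinearMap.congr_fun (diagAct_innerFace i f (η * x) b) y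

theorem coface_castSucc (n : ℕ) (i : Fin (n + 1)) :
    coface (H := H) (B := B) n i.castSucc = innerFace i := by
  simp [coface]

theorem coface_last (n : ℕ) (f : Functional H B n) :
    coface n (Fin.last (n + 1)) f = cyclicOp (n + 1) (coface n 0 f) := by
  have h : (0 : Fin (n + 2)) = Fin.castSucc 0 := rfl
  rw [h, coface_castSucc]
  simp [coface]

theorem coface_mem {hS : Function.Bijective (HopfAlgebra.antipode ℂ : H →ₗ[ℂ] H)} {n : ℕ}
    (i : Fin (n + 2)) {f : Functional H B n} (hf : f ∈ invariantCochains hS n) :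
    coface n i f ∈ invariantCochains hS (n + 1) := by
  induction i using Fin.lastCases with
  | last => 
    simp only [coface, Fin.lastCases_last]
    exact cyclicOp_mem (innerFace_mem 0 hf)
  | cast i => rw [coface_castSucc]; exact innerFace_mem i hf

end Invariance

/-! ### The cyclic operator has order dividing n + 1 on invariant cochains. -/

section Rotation

variable {H B : Type*} [Ring H] [HopfAlgebra ℂ H] [Ring B] [Algebra ℂ B] [RightModuleAlgebra H B]

/-- `slotAct i f ω b = f(ω₍₀₎ ⊗ ⋯ ⊗ bᵢ ◁ ω₍₁₎ ⊗ ⋯)`. -/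
noncomputable def slotAct {m : ℕ} (i : Fin m)
    (f : H →ₗ[ℂ] MultilinearMap ℂ (fun _ : Fin m => B) ℂ) :
    H →ₗ[ℂ] MultilinearMap ℂ (fun _ : Fin m => B) ℂ :=
  sweedler ((((MultilinearMap.compLinearMapMultilinear (R := ℂ) (M₁ := fun _ : Fin m => B)
    (M₁' := fun _ : Fin m => B) (M₂ := ℂ)).toLinearMap (fun _ => LinearMap.id) i) ∘ₗ
      act.flip).flip ∘ₗ f)

/-- The bilinear form whose Sweedler sum is `slotAct i f ω b`. -/
noncomputable def slotForm {m : ℕ} (i : Fin m)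
    (f : H →ₗ[ℂ] MultilinearMap ℂ (fun _ : Fin m => B) ℂ) (b : Fin m → B) :
    H →ₗ[ℂ] H →ₗ[ℂ] ℂ :=
  LinearMap.mk₂ ℂ (fun x y => f x (Function.update b i (act (b i) y)))
    (fun _ _ _ => by simp) (fun _ _ _ => by simp) (fun _ _ _ => by simp) (fun _ _ _ => by simp)

theorem slotAct_apply {m : ℕ} (i : Fin m)
    (f : H →ₗ[ℂ] MultilinearMap ℂ (fun _ : Fin m => B) ℂ) (ω : H) (b : Fin m → B) :
    slotAct i f ω b = sweedler (slotForm i f b) ω := by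
  rw [slotAct, sweedler_apply_eval]
  refine sweedler_congr (fun x y => congrArg (f x) (funext fun j => ?_)) ω
  rcases eq_or_ne j i with rfl | h
  · simp
  · simp [h]

/-- Partial evaluation in the first variable. -/
noncomputable def evalLeft {m : ℕ} (c : B)
    (f : H →ₗ[ℂ] MultilinearMap ℂ (fun _ : Fin (m + 1) => B) ℂ) :
    H →ₗ[ℂ] MultilinearMap ℂ (fun _ : Fin m => B) ℂ :=
  (curryLeftₗ B m ∘ₗ f).flip c

theorem evalLeft_apply {m : ℕ} (c : B)
    (f : H →ₗ[ℂ] MultilinearMap ℂ (fun _ : Fin (m + 1) => B) ℂ) (ω : H) (b : Fin m → B) :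
    evalLeft c f ω b = f ω (Fin.cons c b) := rfl

theorem evalLeft_slotAct_succ {m : ℕ} (i : Fin m) (c : B)
    (f : H →ₗ[ℂ] MultilinearMap ℂ (fun _ : Fin (m + 1) => B) ℂ) :
    evalLeft c (slotAct i.succ f) = slotAct i (evalLeft c f) := by
  refine LinearMap.ext fun ω => MultilinearMap.ext fun b => ?_
  rw [evalLeft_apply, slotAct_apply, slotAct_apply]
  refine sweedler_congr (fun x y => congrArg (f x) ?_) ω
  simp [Fin.cons_update]

/-- Coassociativity lets the leg acting on the first variable be split off from the variable in H
instead of from the diagonal action. -/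
theorem sweedler_diagAct_succ {m : ℕ}
    (f : H →ₗ[ℂ] MultilinearMap ℂ (fun _ : Fin (m + 1) => B) ℂ) (b : Fin (m + 1) → B) (ω : H) :
    sweedler (diagAct (m + 1) b ∘ₗ f) ω =
      sweedler (diagAct m (Fin.tail b) ∘ₗ evalLeft (b 0) (slotAct 0 f)) ω := by
  let κ : H →ₗ[ℂ] H →ₗ[ℂ] MultilinearMap ℂ (fun _ : Fin m => B) ℂ :=
    (curryLeftₗ B m ∘ₗ f).compl₂ (act (b 0))
  have h : evalLeft (b 0) (slotAct 0 f) = sweedler κ := by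
    refine LinearMap.ext fun ω => MultilinearMap.ext fun c => ?_
    rw [evalLeft_apply, slotAct_apply, sweedler_apply_eval]
    refine sweedler_congr (fun x y => congrArg (f x) ?_) ω
    simp
  rw [h, comp_sweedler, sweedler_sweedler]
  rfl

/-- The successive application of `slotAct 0`, …, `slotAct (k - 1)`. -/
noncomputable def slotActs {m : ℕ} (f : H →ₗ[ℂ] MultilinearMap ℂ (fun _ : Fin m => B) ℂ) :
    ℕ → H →ₗ[ℂ] MultilinearMap ℂ (fun _ : Fin m => B) ℂ
  | 0 => f
  | k + 1 => if h : k < m then slotAct ⟨k, h⟩ (slotActs f k) else slotActs f k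

theorem slotActs_succ {m : ℕ} (f : H →ₗ[ℂ] MultilinearMap ℂ (fun _ : Fin m => B) ℂ) {k : ℕ}
    (h : k < m) : slotActs f (k + 1) = slotAct ⟨k, h⟩ (slotActs f k) :=
  dif_pos h

theorem slotActs_succ_of_le {m : ℕ} (f : H →ₗ[ℂ] MultilinearMap ℂ (fun _ : Fin m => B) ℂ) {k : ℕ}
    (h : m ≤ k) : slotActs f (k + 1) = slotActs f k :=
  dif_neg (Nat.not_lt.2 h)

theorem evalLeft_slotActs {m : ℕ} (f : H →ₗ[ℂ] MultilinearMap ℂ (fun _ : Fin (m + 1) => B) ℂ)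
    (c : B) (k : ℕ) :
    evalLeft c (slotActs f (k + 1)) = slotActs (evalLeft c (slotAct 0 f)) k := by
  induction k with
  | zero => rw [slotActs_succ f m.succ_pos]; rfl
  | succ k ih =>
    by_cases h : k < m
    · rw [slotActs_succ _ h, slotActs_succ f (Nat.succ_lt_succ h), ← ih, ← evalLeft_slotAct_succ]
      rfl
    · rw [slotActs_succ_of_le f (k := k + 1) (by omega), ih, slotActs_succ_of_le _ (by omega)]

/-- Each slot action splits a new leg off the variable in H, to the right of which stand the legs of
later slots; after all slots the legs are in the order of the diagonal action. -/
theorem slotActs_self {m : ℕ} (f : H →ₗ[ℂ] MultilinearMap ℂ (fun _ : Fin m => B) ℂ) (ω : H)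
    (b : Fin m → B) : slotActs f m ω b = sweedler (diagAct m b ∘ₗ f) ω := by
  induction m with
  | zero =>
    rw [slotActs, ← evalₗ_apply, ← LinearMap.comp_apply, ← sweedler_counit_right (evalₗ b ∘ₗ f)]
    exact sweedler_congr (fun x y => mul_comm _ _) ω
  | succ m ih =>
    rw [sweedler_diagAct_succ, ← ih, ← evalLeft_slotActs, evalLeft_apply, Fin.cons_self_tail]

/-- `rotate k f ω b = f ω (bᵢ₋ₖ)ᵢ`. -/
noncomputable def rotate {n : ℕ} (k : Fin (n + 1)) (f : Functional H B n) : Functional H B n :=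
  (MultilinearMap.domDomCongrLinearEquiv ℂ ℂ B ℂ (Equiv.subRight k)).toLinearMap ∘ₗ f

theorem rotate_apply {n : ℕ} (k : Fin (n + 1)) (f : Functional H B n) (ω : H)
    (b : Fin (n + 1) → B) : rotate k f ω b = f ω fun i => b (i - k) := rfl

theorem rotate_zero {n : ℕ} (f : Functional H B n) : rotate 0 f = f :=
  LinearMap.ext fun ω => MultilinearMap.ext fun b => by simp [rotate_apply]

theorem rotate_rotate {n : ℕ} (k l : Fin (n + 1)) (f : Functional H B n) :
    rotate k (rotate l f) = rotate (k + l) f :=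
  LinearMap.ext fun ω => MultilinearMap.ext fun b => by
    simp only [rotate_apply]
    congr 1
    funext i
    congr 1
    abel

theorem slotAct_zero_rotate {n : ℕ} (k : Fin (n + 1)) (f : Functional H B n) :
    slotAct 0 (rotate k f) = rotate k (slotAct k f) := by
  refine LinearMap.ext fun ω => MultilinearMap.ext fun b => ?_
  rw [rotate_apply, slotAct_apply, slotAct_apply]
  refine sweedler_congr (fun x y => congrArg (f x) (funext fun j => ?_)) ω
  simp [Function.update_apply, sub_eq_zero]

theorem cons_last_init {n : ℕ} (b : Fin (n + 1) → B) :
    (Fin.cons (b (Fin.last n)) (Fin.init b) : Fin (n + 1) → B) = fun i => b (i - 1) := by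
  funext i
  refine Fin.cases ?_ (fun j => ?_) i
  · have : (0 : Fin (n + 1)) - 1 = Fin.last n := by rw [sub_eq_iff_eq_add, Fin.last_add_one]
    simp [this]
  · have : j.succ - 1 = j.castSucc := by
      rw [sub_eq_iff_eq_add, Fin.coeSucc_eq_succ]
    simp [this, Fin.init]

theorem cyclicOp_eq_rotate {n : ℕ} (f : Functional H B n) :
    cyclicOp n f = rotate 1 (slotAct 0 f) := by
  refine LinearMap.ext fun ω => MultilinearMap.ext fun b => ?_
  rw [rotate_apply, slotAct_apply, cyclicOp_eq, sweedler_apply_eval]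
  refine sweedler_congr (fun x y => congrArg (f x) ?_) ω
  rw [← cons_last_init]
  simp

/-- A cyclic operator is an action on slot 0 followed by a rotation. Moving all rotations to the
outside turns the successive actions on slot 0 into actions on slots 0, 1, …, k - 1. -/
theorem cyclicOp_pow {n : ℕ} (f : Functional H B n) (k : ℕ) (hk : k ≤ n + 1) :
    (cyclicOp n ^ k) f = rotate (Fin.ofNat (n + 1) k) (slotActs f k) := by
  induction k with
  | zero => exact (rotate_zero f).symm
  | succ k ih =>
    rw [pow_succ', Module.End.mul_apply, ih (by omega), cyclicOp_eq_rotate, slotAct_zero_rotate,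
      rotate_rotate, slotActs_succ f hk]
    have h1 : Fin.ofNat (n + 1) k = ⟨k, hk⟩ := Fin.ext (Nat.mod_eq_of_lt hk)
    have h2 : (1 : Fin (n + 1)) + Fin.ofNat (n + 1) k = Fin.ofNat (n + 1) (k + 1) := by
      ext
      simp [Fin.val_add, add_comm]
    rw [h2, ← h1]

/-- After a full turn the rotation is trivial and every slot has been acted on once, in total by the
diagonal action; invariance at η = 1 removes it. -/
theorem cyclicOp_pow_succ {hS : Function.Bijective (HopfAlgebra.antipode ℂ : H →ₗ[ℂ] H)} {n : ℕ}
    {f : Functional H B n} (hf : f ∈ invariantCochains hS n) :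
    (cyclicOp n ^ (n + 1)) f = f := by
  rw [cyclicOp_pow f _ le_rfl]
  have h : Fin.ofNat (n + 1) (n + 1) = 0 := Fin.ext (Nat.mod_self _)
  rw [h, rotate_zero]
  refine LinearMap.ext fun ω => MultilinearMap.ext fun b => ?_
  have h2 := (mem_invariantCochains_iff hS f).1 hf b ω 1
  rw [mul_one] at h2
  rw [slotActs_self, ← h2, diagMul_apply]
  refine sweedler_congr (fun x y => ?_) ω
  simp

end Rotation

/-! ### Tuples indexed by natural numbers. -/

section Tuples

variable {B : Type*}

/-- The extension of a tuple to all natural numbers by `1`. -/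
def extend [One B] {m : ℕ} (b : Fin m → B) (k : ℕ) : B := if h : k < m then b ⟨k, h⟩ else 1

theorem extend_val [One B] {m : ℕ} (b : Fin m → B) (k : Fin m) : extend b k = b k :=
  dif_pos k.2

theorem extend_of_le [One B] {m : ℕ} (b : Fin m → B) {k : ℕ} (h : m ≤ k) : extend b k = 1 :=
  dif_neg (Nat.not_lt.2 h)

theorem extend_contractNth [Monoid B] {m : ℕ} (i : Fin m) (b : Fin (m + 1) → B) (k : ℕ) :
    extend (Fin.contractNth i.castSucc (· * ·) b) k =
      if k < i then extend b k else if k = i then extend b k * extend b (k + 1)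
      else extend b (k + 1) := by
  by_cases hk : k < m
  · simp only [extend, Fin.contractNth]
    rw [dif_pos hk, dif_pos (by omega), dif_pos (by omega)]
    rfl
  · have hi := i.2
    rw [extend_of_le _ (by omega), if_neg (by omega), if_neg (by omega),
      extend_of_le _ (by omega)]

theorem extend_insertNth [One B] {m : ℕ} (i : Fin (m + 1)) (x : B) (b : Fin m → B) (k : ℕ) :
    extend (i.insertNth x b : Fin (m + 1) → B) k =
      if k < i then extend b k else if k = i then x else extend b (k - 1) := by
  by_cases hk : k < m + 1
  · obtain ⟨k, rfl⟩ : ∃ l : Fin (m + 1), (l : ℕ) = k := ⟨⟨k, hk⟩, rfl⟩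
    rw [extend_val]
    rcases lt_trichotomy k i with h | h | h
    · rw [Fin.insertNth_apply_below h, if_pos (show (k : ℕ) < i from h)]
      simp only [eq_rec_constant]
      exact (extend_val b (k.castPred _)).symm
    · subst h
      simp
    · have h' : (i : ℕ) < k := h
      rw [Fin.insertNth_apply_above h, if_neg (by omega), if_neg (by omega)]
      simp only [eq_rec_constant]
      exact (extend_val b (k.pred _)).symm
  · have hi := i.2
    rw [extend_of_le _ (by omega), if_neg (by omega), if_neg (by omega),
      extend_of_le _ (by omega)]

theorem extend_cons [One B] {m : ℕ} (x : B) (b : Fin m → B) (k : ℕ) :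
    extend (Fin.cons x b : Fin (m + 1) → B) k = if k = 0 then x else extend b (k - 1) := by
  cases k with
  | zero => simp [extend]
  | succ k =>
    simp only [extend, Nat.succ_lt_succ_iff]
    rfl

theorem extend_init [One B] {m : ℕ} (b : Fin (m + 1) → B) (k : ℕ) :
    extend (Fin.init b) k = if k < m then extend b k else 1 := by
  split_ifs with h
  · simp only [extend]
    rw [dif_pos h, dif_pos (by omega)]
    rfl
  · exact extend_of_le _ (by omega)

theorem last_eq_extend [One B] {m : ℕ} (b : Fin (m + 1) → B) : b (Fin.last m) = extend b m :=
  (extend_val b (Fin.last m)).symm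

/-- Identities between faces and insertions become case distinctions on natural numbers, without
casts between index types. -/
theorem ext_extend [One B] {m : ℕ} {b c : Fin m → B} (h : ∀ k < m, extend b k = extend c k) :
    b = c :=
  funext fun k => (extend_val b k).symm.trans ((h k k.2).trans (extend_val c k))

end Tuples

/-! ### Relations between cofaces and the cyclic operator. -/

section Cocyclic

variable {H B : Type*} [Ring H] [HopfAlgebra ℂ H] [Ring B] [Algebra ℂ B] [RightModuleAlgebra H B]

/-- The bilinear form whose Sweedler sum is `cyclicOp n f ω b`. -/
noncomputable def cyclicForm {n : ℕ} (f : Functional H B n) (b : Fin (n + 1) → B) :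
    H →ₗ[ℂ] H →ₗ[ℂ] ℂ := (cyclicPairₗ f).compr₂ (evalₗ b)

@[simp]
theorem cyclicForm_apply {n : ℕ} (f : Functional H B n) (b : Fin (n + 1) → B) (x y : H) :
    cyclicForm f b x y = f x (Fin.cons (act (b (Fin.last n)) y) (Fin.init b)) := rfl

theorem cyclicOp_apply {n : ℕ} (f : Functional H B n) (ω : H) (b : Fin (n + 1) → B) :
    cyclicOp n f ω b = sweedler (cyclicForm f b) ω :=
  sweedler_apply_eval _ ω b

theorem innerFace_apply {n : ℕ} (i : Fin (n + 1)) (f : Functional H B n) (ω : H)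
    (b : Fin (n + 2) → B) :
    innerFace i f ω b = f ω (Fin.contractNth i.castSucc (· * ·) b) := rfl

theorem innerFace_innerFace {n : ℕ} {i j : Fin (n + 1)} (h : i ≤ j) (f : Functional H B n) :
    innerFace j.succ (innerFace i f) = innerFace i.castSucc (innerFace j f) := by
  refine LinearMap.ext fun ω => MultilinearMap.ext fun b => congrArg (f ω) (ext_extend ?_)
  intro k hk
  have h' : (i : ℕ) ≤ j := h
  simp only [extend_contractNth, Fin.val_castSucc, Fin.val_succ]
  grind

theorem cyclicOp_innerFace_succ {n : ℕ} (i : Fin n) (f : Functional H B n) :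
    cyclicOp (n + 1) (innerFace i.succ f) = innerFace i.castSucc (cyclicOp n f) := by
  refine LinearMap.ext fun ω => MultilinearMap.ext fun b => ?_
  rw [innerFace_apply, cyclicOp_apply, cyclicOp_apply]
  refine sweedler_congr (fun x y => congrArg (f x) (ext_extend ?_)) ω
  intro k hk
  have hi := i.2
  simp only [extend_contractNth, extend_cons, extend_init, last_eq_extend b,
    last_eq_extend (Fin.contractNth _ _ _), Fin.val_castSucc, Fin.val_succ]
  grind

/-- On the left the last two variables move to the front one by one, each with its own leg, and are
multiplied there; on the right they are multiplied first and moved with one leg. The module algebra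
law and coassociativity identify the two. -/
theorem cyclicOp_cyclicOp_innerFace_zero {n : ℕ} (f : Functional H B n) :
    cyclicOp (n + 1) (cyclicOp (n + 1) (innerFace 0 f)) =
      innerFace (Fin.last n) (cyclicOp n f) := by
  refine LinearMap.ext fun ω => MultilinearMap.ext fun b => ?_
  let d : Fin n → B := Fin.init (Fin.init b)
  let L : H →ₗ[ℂ] B →ₗ[ℂ] ℂ := (curryLeftₗ B n ∘ₗ f).compr₂ (evalₗ d)
  let μ : H →ₗ[ℂ] H →ₗ[ℂ] B :=
    (LinearMap.mul ℂ B).compl₁₂ (act (b (Fin.last n).castSucc)) (act (b (Fin.last (n + 1))))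
  let τ : H →ₗ[ℂ] H →ₗ[ℂ] H →ₗ[ℂ] ℂ :=
    { toFun := fun u => μ.compr₂ (L u)
      map_add' := fun _ _ => by ext; simp
      map_smul' := fun _ _ => by ext; simp }
  have h1 : cyclicOp (n + 1) (cyclicOp (n + 1) (innerFace 0 f)) ω b = sweedler (sweedler τ) ω := by
    rw [cyclicOp_apply]
    refine sweedler_congr (fun x y => ?_) ω
    rw [cyclicForm_apply, cyclicOp_apply, sweedler_apply]
    refine sweedler_congr (fun u v => congrArg (f u) (ext_extend fun k hk => ?_)) x
    change extend (Fin.contractNth (Fin.castSucc 0) _ _) k =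
      extend (Fin.cons (act (b (Fin.last n).castSucc) v * act (b (Fin.last (n + 1))) y) d) k
    have h3 : (Fin.cons (act (b (Fin.last (n + 1))) y) (Fin.init b) : Fin (n + 2) → B)
        (Fin.last (n + 1)) = b (Fin.last n).castSucc := rfl
    simp only [extend_contractNth, extend_cons, extend_init, h3, Fin.val_zero, d]
    grind
  have h2 : innerFace (Fin.last n) (cyclicOp n f) ω b = sweedler (sweedlerₗ ∘ₗ τ) ω := by
    rw [innerFace_apply, cyclicOp_apply]
    refine sweedler_congr (fun x y => ?_) ω
    have h3 : act (b (Fin.last n).castSucc * b (Fin.last (n + 1))) y = sweedler μ y := mul_act _ _ _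
    have h4 : sweedler (τ x) y = L x (sweedler μ y) := (sweedler_map (L x) μ y).symm
    rw [LinearMap.comp_apply, sweedlerₗ_apply, h4, ← h3, cyclicForm_apply]
    have h5 : Fin.contractNth (Fin.last n).castSucc (· * ·) b (Fin.last n) =
        b (Fin.last n).castSucc * b (Fin.last (n + 1)) := by
      simp [Fin.contractNth]
    rw [h5]
    refine congrArg (f x) (ext_extend fun k hk => ?_)
    simp only [extend_contractNth, extend_cons, extend_init, Fin.val_last, d]
    grind
  rw [h1, h2, sweedler_sweedler]

theorem coface_zero (n : ℕ) : coface (H := H) (B := B) n 0 = innerFace 0 := coface_castSucc n 0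

theorem cyclicOp_coface_succ {n : ℕ} (i : Fin (n + 1)) (f : Functional H B n) :
    cyclicOp (n + 1) (coface n i.succ f) = coface n i.castSucc (cyclicOp n f) := by
  induction i using Fin.lastCases with
  | last =>
    rw [Fin.succ_last, coface_last, coface_zero, cyclicOp_cyclicOp_innerFace_zero, coface_castSucc]
  | cast i => rw [Fin.succ_castSucc, coface_castSucc, coface_castSucc, cyclicOp_innerFace_succ]

theorem coface_coface_zero {n : ℕ} (i : Fin (n + 2)) (f : Functional H B n) :
    coface (n + 1) i.succ (coface n 0 f) = coface (n + 1) 0 (coface n i f) := by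
  have h0 : ∀ i : Fin (n + 1), coface (n + 1) i.castSucc.succ (coface n 0 f) =
      coface (n + 1) 0 (coface n i.castSucc f) := fun i => by
    rw [Fin.succ_castSucc, coface_castSucc, coface_castSucc, coface_zero, coface_zero]
    exact innerFace_innerFace (Fin.zero_le i) f
  induction i using Fin.lastCases with
  | last =>
    have h1 := cyclicOp_coface_succ 0 (coface n 0 f)
    have h2 := h0 0
    rw [Fin.castSucc_zero] at h1 h2
    rw [Fin.succ_last, coface_last, coface_last, ← h1, h2]
  | cast i => exact h0 i

/-- Among inner faces this is associativity. The last coface is t d₀, so its relations follow from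
those of d₀ by commuting t past a coface. -/
theorem coface_coface {n : ℕ} {i j : Fin (n + 2)} (h : i ≤ j) (f : Functional H B n) :
    coface (n + 1) j.succ (coface n i f) = coface (n + 1) i.castSucc (coface n j f) := by
  induction j using Fin.lastCases with
  | last =>
    rw [Fin.succ_last, coface_last, coface_last, ← coface_coface_zero, cyclicOp_coface_succ]
  | cast j =>
    obtain ⟨i, rfl⟩ : ∃ i' : Fin (n + 1), i = i'.castSucc :=
      ⟨⟨i, lt_of_le_of_lt h j.2⟩, rfl⟩
    rw [Fin.succ_castSucc, coface_castSucc, coface_castSucc, coface_castSucc, coface_castSucc]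
    exact innerFace_innerFace (i := i) (j := j) h f

end Cocyclic

/-! ### Insertion of the unit. -/

section Degeneracy

variable {H B : Type*} [Ring H] [HopfAlgebra ℂ H] [Ring B] [Algebra ℂ B] [RightModuleAlgebra H B]

/-- Insertion of `1` as the variable with index `i`. -/
noncomputable def insertOne {n : ℕ} (i : Fin (n + 2)) :
    Functional H B (n + 1) →ₗ[ℂ] Functional H B n :=
  LinearMap.compRight ℂ
    ((LinearMap.applyₗ (1 : B)) ∘ₗ
      (MultilinearMap.curryMidLinearEquiv ℂ (fun _ : Fin (n + 2) => B) ℂ i).toLinearMap)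

theorem insertOne_apply {n : ℕ} (i : Fin (n + 2)) (f : Functional H B (n + 1)) (ω : H)
    (b : Fin (n + 1) → B) : insertOne i f ω b = f ω (i.insertNth 1 b) := rfl

theorem insertOne_mem {hS : Function.Bijective (HopfAlgebra.antipode ℂ : H →ₗ[ℂ] H)} {n : ℕ}
    (i : Fin (n + 2)) {f : Functional H B (n + 1)} (hf : f ∈ invariantCochains hS (n + 1)) :
    insertOne i f ∈ invariantCochains hS n := by
  rw [mem_invariantCochains_iff] at hf ⊢
  intro b ω η
  refine Eq.trans ?_ (hf (i.insertNth 1 b) ω η)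
  refine sweedler_congr (fun x y => ?_) ω
  exact LinearMap.congr_fun (diagAct_insertNth_one i (f (η * x)) b).symm y

theorem innerFace_insertOne_of_le {n : ℕ} {i j : Fin (n + 1)} (h : i ≤ j)
    (f : Functional H B (n + 1)) :
    innerFace i (insertOne j.succ f) = insertOne j.succ.succ (innerFace i.castSucc f) := by
  refine LinearMap.ext fun ω => MultilinearMap.ext fun b => congrArg (f ω) (ext_extend ?_)
  intro k hk
  have h' : (i : ℕ) ≤ j := h
  simp only [extend_contractNth, extend_insertNth, Fin.val_castSucc, Fin.val_succ]
  grind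


theorem innerFace_insertOne_of_lt {n : ℕ} {i j : Fin (n + 1)} (h : j < i)
    (f : Functional H B (n + 1)) :
    innerFace i (insertOne j.succ f) = insertOne j.succ.castSucc (innerFace i.succ f) := by
  refine LinearMap.ext fun ω => MultilinearMap.ext fun b => congrArg (f ω) (ext_extend ?_)
  intro k hk
  have h' : (j : ℕ) < i := h
  simp only [extend_contractNth, extend_insertNth, Fin.val_castSucc, Fin.val_succ]
  grind


theorem insertOne_innerFace_self {n : ℕ} (i : Fin (n + 1)) (f : Functional H B n) :
    insertOne i.castSucc (innerFace i f) = f := by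
  refine LinearMap.ext fun ω => MultilinearMap.ext fun b => congrArg (f ω) (ext_extend ?_)
  intro k hk
  simp only [extend_contractNth, extend_insertNth, Fin.val_castSucc]
  grind

theorem cyclicOp_insertOne_succ {n : ℕ} (j : Fin (n + 1)) (f : Functional H B (n + 1)) :
    cyclicOp n (insertOne j.succ f) = insertOne j.castSucc (cyclicOp (n + 1) f) := by
  refine LinearMap.ext fun ω => MultilinearMap.ext fun b => ?_
  rw [insertOne_apply, cyclicOp_apply, cyclicOp_apply]
  refine sweedler_congr (fun x y => congrArg (f x) (ext_extend ?_)) ω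
  intro k hk
  have hj := j.2
  simp only [extend_insertNth, extend_cons, extend_init, last_eq_extend b,
    last_eq_extend (Fin.insertNth _ _ _), Fin.val_castSucc, Fin.val_succ]
  grind

/-- The inserted 1 is rotated to the front, and the leg acting on it is a counit. -/
theorem insertOne_last_cyclicOp {n : ℕ} (f : Functional H B (n + 1)) :
    insertOne (Fin.last (n + 1)) (cyclicOp (n + 1) f) = insertOne 0 f := by
  refine LinearMap.ext fun ω => MultilinearMap.ext fun b => ?_
  rw [insertOne_apply, cyclicOp_apply, insertOne_apply, Fin.insertNth_zero', ← evalₗ_apply,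
    ← LinearMap.comp_apply, ← sweedler_counit_right (evalₗ _ ∘ₗ f)]
  refine sweedler_congr (fun x y => ?_) ω
  simp [one_act, Fin.insertNth_last', MultilinearMap.cons_smul]

theorem insertOne_coface_self {n : ℕ} (i : Fin (n + 2)) (f : Functional H B n) :
    insertOne i (coface n i f) = f := by
  induction i using Fin.lastCases with
  | last =>
    rw [coface_last, insertOne_last_cyclicOp, coface_zero]
    exact insertOne_innerFace_self 0 f
  | cast i => rw [coface_castSucc, insertOne_innerFace_self]

theorem coface_insertOne_of_le {n : ℕ} {i : Fin (n + 2)} {j : Fin (n + 1)} (h : i ≤ j.castSucc)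
    (f : Functional H B (n + 1)) :
    coface n i (insertOne j.succ f) = insertOne j.succ.succ (coface (n + 1) i.castSucc f) := by
  obtain ⟨i, rfl⟩ : ∃ i' : Fin (n + 1), i = i'.castSucc := ⟨⟨i, lt_of_le_of_lt h j.2⟩, rfl⟩
  rw [coface_castSucc, coface_castSucc]
  exact innerFace_insertOne_of_le (i := i) h f

theorem coface_insertOne_of_lt {n : ℕ} {i : Fin (n + 2)} {j : Fin (n + 1)} (h : j.castSucc < i)
    (f : Functional H B (n + 1)) :
    coface n i (insertOne j.succ f) = insertOne j.succ.castSucc (coface (n + 1) i.succ f) := by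
  induction i using Fin.lastCases with
  | last =>
    have h0 := coface_insertOne_of_le (i := 0) (Fin.zero_le j.castSucc) f
    rw [Fin.succ_last, coface_last, coface_last, h0, Fin.castSucc_zero, cyclicOp_insertOne_succ]
  | cast i =>
    rw [Fin.succ_castSucc, coface_castSucc, coface_castSucc]
    exact innerFace_insertOne_of_lt (i := i) h f

end Degeneracy

/-! ### Beta integrals and the coefficients of the gap operators. -/

section Weights

open scoped Nat

/-- The Beta integral `∫ sᵃ (1 - s)ᵇ` over the unit interval. -/
noncomputable def betaWeight (a b : ℕ) : ℂ := a ! * b ! / (a + b + 1)!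

/-- This is s + (1 - s) = 1 under the integral. -/
theorem betaWeight_add (a b : ℕ) :
    betaWeight (a + 1) b + betaWeight a (b + 1) = betaWeight a b := by
  have h1 : a + 1 + b + 1 = (a + b + 1) + 1 := by ring
  have h2 : a + (b + 1) + 1 = (a + b + 1) + 1 := by ring
  have h3 : ((a + b + 1)! : ℂ) ≠ 0 := Nat.cast_ne_zero.2 (Nat.factorial_ne_zero _)
  have h4 : ((a : ℂ) + b + 1 + 1) ≠ 0 := by exact_mod_cast Nat.succ_ne_zero (a + b + 1)
  rw [betaWeight, betaWeight, betaWeight, h1, h2, Nat.factorial_succ (a + b + 1),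
    Nat.factorial_succ a, Nat.factorial_succ b]
  push_cast
  field_simp
  ring

/-- The integral of the derivative of sᵃ⁺¹ (1 - s)ᵇ⁺¹ over the unit interval vanishes. -/
theorem betaWeight_mul (a b : ℕ) :
    ((a + 1 : ℕ) : ℂ) * betaWeight a (b + 1) = ((b + 1 : ℕ) : ℂ) * betaWeight (a + 1) b := by
  have h1 : a + 1 + b + 1 = a + (b + 1) + 1 := by ring
  rw [betaWeight, betaWeight, h1, Nat.factorial_succ a, Nat.factorial_succ b]
  push_cast
  ring

theorem betaWeight_zero_right (a : ℕ) : ((a + 1 : ℕ) : ℂ) * betaWeight a 0 = 1 := by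
  have h3 : (a ! : ℂ) ≠ 0 := Nat.cast_ne_zero.2 (Nat.factorial_ne_zero _)
  have h4 : ((a : ℂ) + 1) ≠ 0 := by exact_mod_cast Nat.succ_ne_zero a
  rw [betaWeight, add_zero, Nat.factorial_succ a]
  push_cast
  field_simp
  simp

theorem betaWeight_zero_left (b : ℕ) : ((b + 1 : ℕ) : ℂ) * betaWeight 0 b = 1 := by
  rw [← betaWeight_zero_right b, betaWeight, betaWeight, zero_add, add_zero, mul_comm (b ! : ℂ)]

/-- The number of indices with value `c`. -/
def boolCount (c : Bool) {m : ℕ} (x : Fin m → Bool) : ℕ := ∑ i, if x i = c then 1 else 0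

theorem boolCount_insertNth (c : Bool) {m : ℕ} (i : Fin (m + 1)) (e : Bool) (y : Fin m → Bool) :
    boolCount c (i.insertNth e y : Fin (m + 1) → Bool) =
      (if e = c then 1 else 0) + boolCount c y := by
  simp [boolCount, Fin.sum_univ_succAbove _ i]

theorem boolCount_pos {c : Bool} {m : ℕ} {x : Fin m → Bool} {j : Fin m} (h : x j = c) :
    0 < boolCount c x :=
  Finset.sum_pos' (fun _ _ => Nat.zero_le _) ⟨j, Finset.mem_univ j, by simp [h]⟩

theorem boolCount_comp_equiv (c : Bool) {m : ℕ} (e : Equiv.Perm (Fin m)) (x : Fin m → Bool) :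
    boolCount c (fun i => x (e i)) = boolCount c x :=
  Equiv.sum_comp e fun i => if x i = c then 1 else 0

theorem boolCount_eq_zero_iff {c : Bool} {m : ℕ} {x : Fin m → Bool} :
    boolCount c x = 0 ↔ x = fun _ => !c := by
  constructor
  · intro h
    funext i
    by_contra hi
    have : x i = c := by revert hi; cases x i <;> cases c <;> simp
    exact (boolCount_pos this).ne' h
  · rintro rfl
    simp [boolCount]

/-- The coefficient of the family of gaps `x` in the operator `gapOp u j`. -/
noncomputable def gapCoeff {m : ℕ} (j : Fin m) (x : Fin m → Bool) : ℂ :=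
  if x j = true then betaWeight (boolCount true x - 1) (boolCount false x)
  else -betaWeight (boolCount true x) (boolCount false x - 1)

/-- Summing over the differentiated gap gives the derivative of s + (1 - s), which is zero. -/
theorem gapCoeff_insertNth_self {m : ℕ} (i : Fin (m + 1)) (y : Fin m → Bool) :
    gapCoeff i (i.insertNth true y : Fin (m + 1) → Bool) +
      gapCoeff i (i.insertNth false y : Fin (m + 1) → Bool) = 0 := by
  simp [gapCoeff, boolCount_insertNth]

/-- Summing over a gap that is not differentiated gives the factor s + (1 - s) = 1. -/
theorem gapCoeff_insertNth {m : ℕ} (i : Fin (m + 1)) (j : Fin m) (y : Fin m → Bool) :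
    gapCoeff (i.succAbove j) (i.insertNth true y : Fin (m + 1) → Bool) +
      gapCoeff (i.succAbove j) (i.insertNth false y : Fin (m + 1) → Bool) = gapCoeff j y := by
  cases h : y j with
  | true =>
    obtain ⟨a, ha⟩ := Nat.exists_eq_add_one.2 (boolCount_pos h)
    simp only [gapCoeff, Fin.insertNth_apply_succAbove, h, if_true, boolCount_insertNth, ha]
    simp [add_comm, ← betaWeight_add a (boolCount false y)]
  | false =>
    obtain ⟨a, ha⟩ := Nat.exists_eq_add_one.2 (boolCount_pos h)
    simp only [gapCoeff, Fin.insertNth_apply_succAbove, h, boolCount_insertNth, ha]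
    simp [add_comm, ← betaWeight_add (boolCount true y) a]

/-- The sum is the integral of the derivative of sᵃ (1 - s)ᵇ, with a and b the numbers of the two
values of x. The boundary values vanish unless x is constant. -/
theorem sum_gapCoeff {m : ℕ} (x : Fin (m + 1) → Bool) :
    ∑ j, gapCoeff j x =
      (if x = fun _ => true then 1 else 0) - (if x = fun _ => false then 1 else 0) := by
  have h1 : ∑ j, gapCoeff j x =
      boolCount true x * betaWeight (boolCount true x - 1) (boolCount false x) -
      boolCount false x * betaWeight (boolCount true x) (boolCount false x - 1) := by
    have h : ∀ j, gapCoeff j x =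
        ((if x j = true then 1 else 0 : ℕ) : ℂ) *
          betaWeight (boolCount true x - 1) (boolCount false x) -
        ((if x j = false then 1 else 0 : ℕ) : ℂ) *
          betaWeight (boolCount true x) (boolCount false x - 1) := by
      intro j
      cases h : x j <;> simp [gapCoeff, h]
    rw [Finset.sum_congr rfl fun j _ => h j, Finset.sum_sub_distrib, ← Finset.sum_mul,
      ← Finset.sum_mul, ← Nat.cast_sum, ← Nat.cast_sum]
    rfl
  rw [h1]
  have ht := boolCount_eq_zero_iff (c := true) (x := x)
  have hf := boolCount_eq_zero_iff (c := false) (x := x)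
  simp only [Bool.not_true, Bool.not_false] at ht hf
  -- Where a count is zero, the truncated `- 1` sits in a term with coefficient zero. Both counts
  -- cannot vanish, since there is at least one gap.
  rcases hT : boolCount true x with _ | a <;> rcases hF : boolCount false x with _ | b
  · have h2 := congrFun ((ht.1 hT).symm.trans (hf.1 hF)) 0
    simp at h2
  · have h2 := ht.1 hT
    have h3 : x ≠ fun _ => true := fun h => by rw [hf.2 h] at hF; cases hF
    rw [if_neg h3, if_pos h2, Nat.add_sub_cancel, betaWeight_zero_left]
    simp
  · have h2 := hf.1 hF
    have h3 : x ≠ fun _ => false := fun h => by rw [ht.2 h] at hT; cases hT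
    rw [if_neg h3, if_pos h2, Nat.add_sub_cancel, betaWeight_zero_right]
    simp
  · have h2 : x ≠ fun _ => true := fun h => by rw [hf.2 h] at hF; cases hF
    have h3 : x ≠ fun _ => false := fun h => by rw [ht.2 h] at hT; cases hT
    rw [if_neg h2, if_neg h3, Nat.add_sub_cancel, Nat.add_sub_cancel, betaWeight_mul, sub_self,
      sub_self]

theorem sum_insertNth {M : Type*} [AddCommMonoid M] {m : ℕ} (i : Fin (m + 1))
    (F : (Fin (m + 1) → Bool) → M) :
    ∑ x, F x = ∑ y : Fin m → Bool, (F (i.insertNth true y) + F (i.insertNth false y)) := by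
  rw [← (Fin.insertNthEquiv (fun _ => Bool) i).sum_comp, Fintype.sum_prod_type, Fintype.sum_bool,
    ← Finset.sum_add_distrib]
  rfl

end Weights

/-! ### Conjugation in the gaps and the integrated derivatives. -/

section Gaps

variable {H B : Type*} [Ring H] [HopfAlgebra ℂ H] [Ring B] [Algebra ℂ B] [RightModuleAlgebra H B]

/-- Conjugation in the gaps: `bᵢ` is replaced by `xᵢ₋₁ bᵢ xᵢ⁻¹`, with cyclic indices. -/
noncomputable def gapConj {n : ℕ} (x : Fin (n + 1) → Bˣ) : Functional H B n →ₗ[ℂ] Functional H B n :=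
  LinearMap.compRight ℂ (MultilinearMap.compLinearMapₗ fun i =>
    LinearMap.mulRight ℂ (((x i)⁻¹ : Bˣ) : B) ∘ₗ LinearMap.mulLeft ℂ
      (((Fin.cons (x (Fin.last n)) (Fin.init x) : Fin (n + 1) → Bˣ) i : Bˣ) : B))

theorem gapConj_apply {n : ℕ} (x : Fin (n + 1) → Bˣ) (f : Functional H B n) (ω : H)
    (b : Fin (n + 1) → B) :
    gapConj x f ω b = f ω fun i =>
      ((Fin.cons (x (Fin.last n)) (Fin.init x) : Fin (n + 1) → Bˣ) i : B) * b i *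
        (((x i)⁻¹ : Bˣ) : B) := rfl

theorem gapConj_const {n : ℕ} (u : Bˣ) (f : Functional H B n) :
    gapConj (fun _ => u) f = pullback H ((Ad u : B ≃ₐ[ℂ] B) : B →ₐ[ℂ] B) n f := by
  refine LinearMap.ext fun ω => MultilinearMap.ext fun b => congrArg (f ω) (funext fun i => ?_)
  refine Fin.cases ?_ (fun j => ?_) i <;> rfl

theorem gapConj_one {n : ℕ} (f : Functional H B n) : gapConj (fun _ => 1) f = f := by
  rw [gapConj_const]
  refine LinearMap.ext fun ω => MultilinearMap.ext fun b => congrArg (f ω) (funext fun i => ?_)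
  simp [Ad_apply]

theorem isEquivariant_conj {u v : Bˣ} (hu : IsInvariant H (u : B)) (hv : IsInvariant H (v : B)) :
    IsEquivariant H (LinearMap.mulRight ℂ ((v⁻¹ : Bˣ) : B) ∘ₗ LinearMap.mulLeft ℂ (u : B)) := by
  intro x ω
  simp only [LinearMap.comp_apply, LinearMap.mulLeft_apply, LinearMap.mulRight_apply]
  rw [act_mul_of_right hv.inv, act_mul_of_left hu]

theorem gapConj_mem {hS : Function.Bijective (HopfAlgebra.antipode ℂ : H →ₗ[ℂ] H)} {n : ℕ}
    {x : Fin (n + 1) → Bˣ} (hx : ∀ i, IsInvariant H (x i : B)) {f : Functional H B n}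
    (hf : f ∈ invariantCochains hS n) : gapConj x f ∈ invariantCochains hS n := by
  rw [mem_invariantCochains_iff] at hf ⊢
  intro b ω η
  refine Eq.trans ?_ (hf _ ω η)
  refine sweedler_congr (fun p y => ?_) ω
  have hL : ∀ i, IsEquivariant H (LinearMap.mulRight ℂ (((x i)⁻¹ : Bˣ) : B) ∘ₗ LinearMap.mulLeft ℂ
      (((Fin.cons (x (Fin.last n)) (Fin.init x) : Fin (n + 1) → Bˣ) i : Bˣ) : B)) := by
    intro i
    refine isEquivariant_conj ?_ (hx i)
    refine Fin.cases (hx _) (fun j => hx _) i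
  exact LinearMap.congr_fun (diagAct_compLinearMap_pi hL (f (η * p)) b) y

/-- Rotating the variables rotates the gaps. Invariance of the xᵢ is needed for the variable that is
moved, since the action has to pass the conjugating factors. -/
theorem cyclicOp_gapConj {n : ℕ} {x : Fin (n + 1) → Bˣ} (hx : ∀ i, IsInvariant H (x i : B))
    (f : Functional H B n) :
    cyclicOp n (gapConj x f) = gapConj (fun i => x (i + 1)) (cyclicOp n f) := by
  have h1 : (Fin.cons (x (Fin.last n + 1)) (Fin.init fun i => x (i + 1)) : Fin (n + 1) → Bˣ) =
      x := by
    funext i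
    refine Fin.cases ?_ (fun j => ?_) i
    · simp
    · simp [Fin.init, Fin.coeSucc_eq_succ]
  refine LinearMap.ext fun ω => MultilinearMap.ext fun b => ?_
  rw [gapConj_apply, cyclicOp_apply, cyclicOp_apply, h1]
  refine sweedler_congr (fun p y => ?_) ω
  rw [cyclicForm_apply, cyclicForm_apply, gapConj_apply]
  refine congrArg (f p) (funext fun i => ?_)
  refine Fin.cases ?_ (fun j => ?_) i
  · simp only [Fin.cons_zero, Fin.last_add_one]
    rw [act_mul_of_right (hx 0).inv, act_mul_of_left (hx _)]
  · simp [Fin.init, Fin.coeSucc_eq_succ]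

theorem extend_comp_succAbove {C : Type*} [One C] {m : ℕ} (p : Fin (m + 1)) (x : Fin (m + 1) → C)
    (k : ℕ) : extend (fun i => x (p.succAbove i)) k =
      if k < p then extend x k else extend x (k + 1) := by
  by_cases hk : k < m
  · simp only [extend, Fin.succAbove, Fin.lt_def, Fin.val_castSucc]
    rw [dif_pos hk, dif_pos (by omega), dif_pos (by omega)]
    split_ifs <;> rfl
  · have hp := p.2
    rw [extend_of_le _ (by omega), if_neg (by omega), extend_of_le _ (by omega)]

theorem extend_conj {n : ℕ} (x : Fin (n + 1) → Bˣ) (b : Fin (n + 1) → B) (k : ℕ) :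
    extend (fun i => ((Fin.cons (x (Fin.last n)) (Fin.init x) : Fin (n + 1) → Bˣ) i : B) * b i *
        (((x i)⁻¹ : Bˣ) : B)) k =
      if k = 0 then ((extend x n : Bˣ) : B) * extend b 0 * (((extend x 0)⁻¹ : Bˣ) : B)
      else if k < n + 1 then ((extend x (k - 1) : Bˣ) : B) * extend b k * (((extend x k)⁻¹ : Bˣ) : B)
      else 1 := by
  split_ifs with h0 h1
  · subst h0
    exact congrArg (fun a : Bˣ => (a : B) * b 0 * (((x 0)⁻¹ : Bˣ) : B)) (last_eq_extend x)
  · obtain ⟨j, rfl⟩ := Nat.exists_eq_succ_of_ne_zero h0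
    have h2 : j < n + 1 := by omega
    simp only [extend, Nat.succ_eq_add_one, Nat.add_sub_cancel, h1, h2, dif_pos]
    rfl
  · exact extend_of_le _ (by omega)

/-- In the product of neighbours the factors xᵢ⁻¹ and xᵢ meet and cancel, so the face does not see
gap i. -/
theorem gapConj_innerFace {n : ℕ} (x : Fin (n + 2) → Bˣ) (i : Fin (n + 1)) (f : Functional H B n) :
    gapConj x (innerFace i f) =
      innerFace i (gapConj (fun k => x (i.castSucc.succAbove k)) f) := by
  refine LinearMap.ext fun ω => MultilinearMap.ext fun b => ?_
  rw [gapConj_apply, innerFace_apply, innerFace_apply, gapConj_apply]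
  refine congrArg (f ω) (ext_extend fun k hk => ?_)
  have hi := i.2
  rw [extend_contractNth, extend_conj, extend_conj,
    extend_conj (fun k => x (i.castSucc.succAbove k)) (Fin.contractNth i.castSucc (· * ·) b)]
  simp only [extend_comp_succAbove, extend_contractNth, Fin.val_castSucc]
  rcases k with _ | k
  · split_ifs <;> first | omega | simp_all [mul_assoc]
  · split_ifs <;> first | omega | simp_all [mul_assoc]

theorem gapConj_coface {n : ℕ} {x : Fin (n + 2) → Bˣ} (hx : ∀ i, IsInvariant H (x i : B))
    (i : Fin (n + 2)) (f : Functional H B n) :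
    gapConj x (coface n i f) = coface n i (gapConj (fun k => x (i.succAbove k)) f) := by
  induction i using Fin.lastCases with
  | last =>
    -- With the gaps shifted back, the gap 0 that d₀ forgets carries the last entry of x, which is
    -- the one forgotten by the last coface.
    have h := cyclicOp_gapConj (x := fun i => x (i - 1)) (fun i => hx _) (coface n 0 f)
    simp only [add_sub_cancel_right] at h
    rw [coface_last, coface_last, ← h, coface_zero, gapConj_innerFace]
    have h2 : ∀ k : Fin (n + 1), (Fin.castSucc 0).succAbove k - 1 =
        (Fin.last (n + 1)).succAbove k := fun k => by
      simp [sub_eq_iff_eq_add, Fin.coeSucc_eq_succ]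
    simp only [h2]
  | cast i => rw [coface_castSucc, gapConj_innerFace]

variable {u : Bˣ}

/-- The derivative in the gap `j` of the path of operators which connects the identity with
`gapConj u`, integrated over the path. -/
noncomputable def gapOp (u : Bˣ) {n : ℕ} (j : Fin (n + 1)) : Functional H B n →ₗ[ℂ] Functional H B n :=
  ∑ x : Fin (n + 1) → Bool, gapCoeff j x • gapConj fun i => if x i = true then u else 1

theorem gapOp_apply {n : ℕ} (j : Fin (n + 1)) (f : Functional H B n) :
    gapOp u j f = ∑ x : Fin (n + 1) → Bool,
      gapCoeff j x • gapConj (fun i => if x i = true then u else 1) f := by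
  simp [gapOp]

theorem isInvariant_ite (hu : IsInvariant H (u : B)) (c : Bool) :
    IsInvariant H ((if c = true then u else 1 : Bˣ) : B) := by
  split_ifs
  · exact hu
  · exact fun ω => by simp [one_act]

theorem gapOp_mem {hS : Function.Bijective (HopfAlgebra.antipode ℂ : H →ₗ[ℂ] H)} {n : ℕ}
    (hu : IsInvariant H (u : B)) (j : Fin (n + 1)) {f : Functional H B n}
    (hf : f ∈ invariantCochains hS n) : gapOp u j f ∈ invariantCochains hS n := by
  rw [gapOp_apply]
  exact Submodule.sum_mem _ fun x _ =>
    Submodule.smul_mem _ _ (gapConj_mem (fun i => isInvariant_ite hu _) hf)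

theorem gapConj_ite_coface (hu : IsInvariant H (u : B)) {n : ℕ} (i : Fin (n + 2)) (e : Bool)
    (y : Fin (n + 1) → Bool) (f : Functional H B n) :
    gapConj (fun k => if (i.insertNth e y : Fin (n + 2) → Bool) k = true then u else 1)
      (coface n i f) = coface n i (gapConj (fun k => if y k = true then u else 1) f) := by
  rw [gapConj_coface fun i => isInvariant_ite hu _]
  simp

theorem gapOp_coface_self (hu : IsInvariant H (u : B)) {n : ℕ} (i : Fin (n + 2))
    (f : Functional H B n) : gapOp u i (coface n i f) = 0 := by
  rw [gapOp_apply, sum_insertNth i]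
  simp only [gapConj_ite_coface hu, ← add_smul, gapCoeff_insertNth_self, zero_smul,
    Finset.sum_const_zero]

theorem gapOp_coface (hu : IsInvariant H (u : B)) {n : ℕ} (i : Fin (n + 2)) (j : Fin (n + 1))
    (f : Functional H B n) :
    gapOp u (i.succAbove j) (coface n i f) = coface n i (gapOp u j f) := by
  rw [gapOp_apply, gapOp_apply, sum_insertNth i]
  simp only [gapConj_ite_coface hu, ← add_smul, gapCoeff_insertNth, map_sum, map_smul]

/-- The coefficient depends only on the value at the distinguished gap and on the two counts, so a
simultaneous shift of gaps and families leaves it unchanged. -/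
theorem cyclicOp_gapOp (hu : IsInvariant H (u : B)) {n : ℕ} (j : Fin (n + 1))
    (f : Functional H B n) :
    cyclicOp n (gapOp u (j + 1) f) = gapOp u j (cyclicOp n f) := by
  rw [gapOp_apply, gapOp_apply, map_sum]
  refine Fintype.sum_equiv (Equiv.arrowCongr (Equiv.subRight 1) (Equiv.refl Bool)) _ _ fun x => ?_
  rw [map_smul, cyclicOp_gapConj fun i => isInvariant_ite hu _]
  have h : (Equiv.arrowCongr (Equiv.subRight (1 : Fin (n + 1))) (Equiv.refl Bool)) x =
      fun i => x (i + 1) := by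
    funext i
    simp [Equiv.arrowCongr]
  rw [h]
  congr 1
  have hc := fun c => boolCount_comp_equiv c (Equiv.addRight (1 : Fin (n + 1))) x
  simp only [Equiv.coe_addRight] at hc
  simp only [gapCoeff, hc]

theorem sum_gapOp {n : ℕ} (f : Functional H B n) :
    ∑ j, gapOp u j f = pullback H ((Ad u : B ≃ₐ[ℂ] B) : B →ₐ[ℂ] B) n f - f := by
  simp only [gapOp_apply]
  rw [Finset.sum_comm]
  simp only [← Finset.sum_smul, sum_gapCoeff, sub_smul, ite_smul, one_smul, zero_smul,
    Finset.sum_sub_distrib, Finset.sum_ite_eq', Finset.mem_univ, if_true]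
  simp only [gapConj_const, Bool.false_eq_true, if_false]
  rw [← gapConj_const 1, gapConj_one]

end Gaps

/-! ### Rearrangement of double sums over cofaces. -/

section AlternatingSums

variable {M : Type*} [AddCommGroup M]

theorem sum_lt_castSucc {n : ℕ} (G : Fin (n + 2) → Fin (n + 1) → M) :
    ∑ i : Fin (n + 2), ∑ j : Fin (n + 1), (if i < j.castSucc then G i j else 0) =
      ∑ i : Fin (n + 1), ∑ j : Fin n, if i ≤ j.castSucc then G i.castSucc j.succ else 0 := by
  rw [Fin.sum_univ_castSucc]
  have h : ∀ j : Fin (n + 1), ¬ Fin.last (n + 1) < j.castSucc := fun j => by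
    rw [not_lt]; exact Fin.le_last _
  simp only [h, if_false, Finset.sum_const_zero, add_zero]
  refine Finset.sum_congr rfl fun i _ => ?_
  rw [Fin.sum_univ_succ, if_neg (by simp), zero_add]
  refine Finset.sum_congr rfl fun j _ => ?_
  refine if_congr ?_ rfl rfl
  simp only [Fin.lt_def, Fin.le_def, Fin.val_castSucc, Fin.val_succ]
  omega

theorem sum_succ_lt {n : ℕ} (G : Fin (n + 2) → Fin (n + 1) → M) :
    ∑ i : Fin (n + 2), ∑ j : Fin (n + 1), (if j.succ < i then G i j else 0) =
      ∑ i : Fin (n + 1), ∑ j : Fin n, if i ≤ j.castSucc then 0 else G i.succ j.castSucc := by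
  rw [Fin.sum_univ_succ]
  simp only [Fin.not_lt_zero, if_false, Finset.sum_const_zero, zero_add]
  refine Finset.sum_congr rfl fun i _ => ?_
  rw [Fin.sum_univ_castSucc, if_neg (by
    rw [not_lt, Fin.succ_last]; exact Fin.le_last _), add_zero]
  refine Finset.sum_congr rfl fun j _ => ?_
  rw [← ite_not (p := i ≤ j.castSucc)]
  refine if_congr ?_ rfl rfl
  simp only [Fin.lt_def, Fin.le_def, Fin.val_castSucc, Fin.val_succ]
  omega

/-- The pairs i = j and i = j + 1 are separated. The remaining pairs are reindexed to match the
double sum obtained when the coface is applied last, so that a homotopy formula can be read off. -/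
theorem sum_eq_of_eq_castSucc {n : ℕ} (G : Fin (n + 2) → Fin (n + 1) → M) :
    ∑ i : Fin (n + 2), ∑ j : Fin (n + 1), G i j =
      ∑ j : Fin (n + 1), G j.castSucc j + ∑ j : Fin (n + 1), G j.succ j +
      ∑ i : Fin (n + 1), ∑ j : Fin n,
        if i ≤ j.castSucc then G i.castSucc j.succ else G i.succ j.castSucc := by
  have h : ∀ (i : Fin (n + 2)) (j : Fin (n + 1)), G i j =
      (if i = j.castSucc then G i j else 0) + (if i = j.succ then G i j else 0) +
      (if i < j.castSucc then G i j else 0) + (if j.succ < i then G i j else 0) := by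
    intro i j
    simp only [Fin.ext_iff, Fin.lt_def, Fin.val_castSucc, Fin.val_succ]
    rcases lt_trichotomy (i : ℕ) j with h | h | h
    · rw [if_neg (by omega), if_neg (by omega), if_pos h, if_neg (by omega)]; simp
    · rw [if_pos (by omega), if_neg (by omega), if_neg (by omega), if_neg (by omega)]; simp
    · rcases eq_or_lt_of_le (Nat.succ_le_of_lt h) with h | h
      · rw [if_neg (by omega), if_pos (by omega), if_neg (by omega), if_neg (by omega)]; simp
      · rw [if_neg (by omega), if_neg (by omega), if_neg (by omega), if_pos (by omega)]; simp
  have h2 : ∀ (i : Fin (n + 1)) (j : Fin n),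
      (if i ≤ j.castSucc then G i.castSucc j.succ else G i.succ j.castSucc) =
      (if i ≤ j.castSucc then G i.castSucc j.succ else 0) +
        if i ≤ j.castSucc then 0 else G i.succ j.castSucc := by
    intro i j
    split_ifs <;> simp
  rw [Finset.sum_congr rfl fun i _ => Finset.sum_congr rfl fun j _ => h i j]
  simp only [h2, Finset.sum_add_distrib]
  rw [sum_lt_castSucc, sum_succ_lt, ← add_assoc]
  congr 3
  · rw [Finset.sum_comm]; simp
  · rw [Finset.sum_comm]; simp

/-- For i ≤ j the terms at (j + 1, i) and (i, j) have opposite signs, and these pairs exhaust the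
sum. -/
theorem sum_sum_eq_zero [Module ℂ M] {n : ℕ} {G : Fin (n + 1) → Fin n → M}
    (h : ∀ i j : Fin n, i ≤ j → G j.succ i = G i.castSucc j) :
    ∑ j : Fin (n + 1), ∑ i : Fin n, (-1 : ℂ) ^ (j + i : ℕ) • G j i = 0 := by
  have h1 : ∀ (j : Fin (n + 1)) (i : Fin n), (-1 : ℂ) ^ (j + i : ℕ) • G j i =
      (if i.castSucc < j then (-1 : ℂ) ^ (j + i : ℕ) • G j i else 0) +
        (if j ≤ i.castSucc then (-1 : ℂ) ^ (j + i : ℕ) • G j i else 0) := by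
    intro j i
    rcases lt_or_ge i.castSucc j with h | h
    · rw [if_pos h, if_neg (not_le.2 h), add_zero]
    · rw [if_neg (not_lt.2 h), if_pos h, zero_add]
  simp only [Finset.sum_congr rfl fun j _ => Finset.sum_congr rfl fun i _ => h1 j i,
    Finset.sum_add_distrib]
  rw [Fin.sum_univ_succ (n := n), Fin.sum_univ_castSucc (n := n)
    (f := fun j => ∑ i : Fin n, if j ≤ i.castSucc then (-1 : ℂ) ^ (j + i : ℕ) • G j i else 0)]
  have h2 : ∀ i : Fin n, ¬ i.castSucc < 0 := fun i => Fin.not_lt_zero _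
  have h3 : ∀ i : Fin n, ¬ Fin.last n ≤ i.castSucc := fun i => not_le.2 (Fin.castSucc_lt_last i)
  simp only [h2, h3, if_false, Finset.sum_const_zero, zero_add, add_zero]
  rw [Finset.sum_comm (γ := Fin n) (f := fun j i : Fin n => if j.castSucc ≤ i.castSucc then
    (-1 : ℂ) ^ (j.castSucc + i : ℕ) • G j.castSucc i else 0), ← Finset.sum_add_distrib]
  refine Finset.sum_eq_zero fun j _ => ?_
  rw [← Finset.sum_add_distrib]
  refine Finset.sum_eq_zero fun i _ => ?_
  by_cases hij : i ≤ j
  · rw [if_pos (Fin.castSucc_lt_succ_iff.2 hij), if_pos (Fin.castSucc_le_castSucc_iff.2 hij),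
      h i j hij, ← add_smul]
    simp only [Fin.val_castSucc, Fin.val_succ]
    rw [show (j + 1 + i : ℕ) = (i + j) + 1 by ring, pow_succ]
    simp
  · rw [if_neg (fun h => hij (Fin.castSucc_lt_succ_iff.1 h)),
      if_neg (fun h => hij (Fin.castSucc_le_castSucc_iff.1 h)), add_zero]

end AlternatingSums

/-! ### The bicomplex and the exactness of its rows. -/

section Differentials

variable {H B : Type*} [Ring H] [HopfAlgebra ℂ H] [Ring B] [Algebra ℂ B] [RightModuleAlgebra H B]

theorem neg_smul_functional {n : ℕ} (c : ℂ) (f : Functional H B n) : (-c) • f = -(c • f) :=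
  LinearMap.ext fun ω => MultilinearMap.ext fun b => neg_mul c (f ω b)

theorem hochschild_apply {n : ℕ} (f : Functional H B n) :
    hochschild n f = ∑ i : Fin (n + 2), (-1 : ℂ) ^ (i : ℕ) • coface n i f := by
  simp [hochschild]

theorem hochschild'_apply {n : ℕ} (f : Functional H B n) :
    hochschild' n f = ∑ i : Fin (n + 1), (-1 : ℂ) ^ (i : ℕ) • coface n i.castSucc f := by
  simp [hochschild']

theorem hochschild_hochschild {n : ℕ} (f : Functional H B n) :
    hochschild (n + 1) (hochschild n f) = 0 := by
  rw [hochschild_apply (hochschild n f), hochschild_apply f]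
  simp only [map_sum, map_smul, Finset.smul_sum, smul_smul, ← pow_add]
  exact sum_sum_eq_zero (G := fun j i => coface (n + 1) j (coface n i f))
    fun i j h => coface_coface h f

theorem hochschild'_hochschild' {n : ℕ} (f : Functional H B n) :
    hochschild' (n + 1) (hochschild' n f) = 0 := by
  rw [hochschild'_apply (hochschild' n f), hochschild'_apply f]
  simp only [map_sum, map_smul, Finset.smul_sum, smul_smul, ← pow_add]
  refine sum_sum_eq_zero (G := fun j i => coface (n + 1) j.castSucc (coface n i.castSucc f))
    fun i j h => ?_
  rw [← Fin.succ_castSucc]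
  exact coface_coface (Fin.castSucc_le_castSucc_iff.2 h) f

theorem signedCyclicOp_apply {n : ℕ} (f : Functional H B n) :
    signedCyclicOp n f = (-1 : ℂ) ^ n • cyclicOp n f := rfl

theorem signedCyclicOp_coface_succ {n : ℕ} (i : Fin (n + 1)) (f : Functional H B n) :
    signedCyclicOp (n + 1) (coface n i.succ f) = -coface n i.castSucc (signedCyclicOp n f) := by
  rw [signedCyclicOp_apply, signedCyclicOp_apply, cyclicOp_coface_succ, map_smul, pow_succ,
    mul_neg_one, neg_smul_functional]

/-- In the sum for b, the first coface goes under λ to the signed last coface, which is b - b', and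
the others are shifted down. Equivalently (1 - λ)b = b'(1 - λ). -/
theorem signedCyclicOp_hochschild {n : ℕ} (f : Functional H B n) :
    signedCyclicOp (n + 1) (hochschild n f) =
      hochschild n f - hochschild' n f + hochschild' n (signedCyclicOp n f) := by
  have h1 : hochschild n f - hochschild' n f = signedCyclicOp (n + 1) (coface n 0 f) := by
    rw [hochschild_apply, hochschild'_apply, Fin.sum_univ_castSucc, coface_last]
    simp [signedCyclicOp_apply]
  rw [h1, hochschild_apply, hochschild'_apply, Fin.sum_univ_succ, map_add, map_sum]
  congr 1
  · simp
  · refine Finset.sum_congr rfl fun i _ => ?_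
    rw [map_smul, signedCyclicOp_coface_succ, Fin.val_succ, pow_succ]
    simp

theorem signedCyclicOp_mem {hS : Function.Bijective (HopfAlgebra.antipode ℂ : H →ₗ[ℂ] H)} {n : ℕ}
    {f : Functional H B n} (hf : f ∈ invariantCochains hS n) :
    signedCyclicOp n f ∈ invariantCochains hS n :=
  Submodule.smul_mem _ _ (cyclicOp_mem hf)

theorem signedCyclicOp_pow_mem {hS : Function.Bijective (HopfAlgebra.antipode ℂ : H →ₗ[ℂ] H)}
    {n : ℕ} (k : ℕ) {f : Functional H B n} (hf : f ∈ invariantCochains hS n) :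
    (signedCyclicOp n ^ k) f ∈ invariantCochains hS n := by
  induction k with
  | zero => exact hf
  | succ k ih => rw [pow_succ']; exact signedCyclicOp_mem ih

theorem cyclicNorm_mem {hS : Function.Bijective (HopfAlgebra.antipode ℂ : H →ₗ[ℂ] H)} {n : ℕ}
    {f : Functional H B n} (hf : f ∈ invariantCochains hS n) :
    cyclicNorm n f ∈ invariantCochains hS n := by
  rw [cyclicNorm, LinearMap.sum_apply]
  exact Submodule.sum_mem _ fun i _ => signedCyclicOp_pow_mem i hf

theorem hochschild_mem {hS : Function.Bijective (HopfAlgebra.antipode ℂ : H →ₗ[ℂ] H)} {n : ℕ}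
    {f : Functional H B n} (hf : f ∈ invariantCochains hS n) :
    hochschild n f ∈ invariantCochains hS (n + 1) := by
  rw [hochschild_apply]
  exact Submodule.sum_mem _ fun i _ => Submodule.smul_mem _ _ (coface_mem i hf)

theorem hochschild'_mem {hS : Function.Bijective (HopfAlgebra.antipode ℂ : H →ₗ[ℂ] H)} {n : ℕ}
    {f : Functional H B n} (hf : f ∈ invariantCochains hS n) :
    hochschild' n f ∈ invariantCochains hS (n + 1) := by
  rw [hochschild'_apply]
  exact Submodule.sum_mem _ fun i _ => Submodule.smul_mem _ _ (coface_mem _ hf)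

theorem signedCyclicOp_pow_succ {hS : Function.Bijective (HopfAlgebra.antipode ℂ : H →ₗ[ℂ] H)}
    {n : ℕ} {f : Functional H B n} (hf : f ∈ invariantCochains hS n) :
    (signedCyclicOp n ^ (n + 1)) f = f := by
  rw [signedCyclicOp, smul_pow, LinearMap.smul_apply, cyclicOp_pow_succ hf, ← pow_mul,
    (Nat.even_mul_succ_self n).neg_one_pow, one_smul]

/-- The geometric sum gives N(1 - λ) = 1 - λ ^ (n + 1), which vanishes on invariant cochains. -/
theorem cyclicNorm_signedCyclicOp {hS : Function.Bijective (HopfAlgebra.antipode ℂ : H →ₗ[ℂ] H)}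
    {n : ℕ} {f : Functional H B n} (hf : f ∈ invariantCochains hS n) :
    cyclicNorm n (signedCyclicOp n f) = cyclicNorm n f := by
  have h : cyclicNorm n (f - signedCyclicOp n f) = f - (signedCyclicOp n ^ (n + 1)) f :=
    LinearMap.congr_fun (geom_sum_mul_neg (R := Module.End ℂ (Functional H B n))
      (signedCyclicOp n) (n + 1)) f
  rw [signedCyclicOp_pow_succ hf, sub_self, map_sub] at h
  exact (sub_eq_zero.1 h).symm

theorem signedCyclicOp_cyclicNorm {hS : Function.Bijective (HopfAlgebra.antipode ℂ : H →ₗ[ℂ] H)}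
    {n : ℕ} {f : Functional H B n} (hf : f ∈ invariantCochains hS n) :
    signedCyclicOp n (cyclicNorm n f) = cyclicNorm n f := by
  have h : cyclicNorm n f - signedCyclicOp n (cyclicNorm n f) =
      f - (signedCyclicOp n ^ (n + 1)) f :=
    LinearMap.congr_fun (mul_neg_geom_sum (R := Module.End ℂ (Functional H B n))
      (signedCyclicOp n) (n + 1)) f
  rw [signedCyclicOp_pow_succ hf, sub_self] at h
  exact (sub_eq_zero.1 h).symm

theorem cyclicNorm_signedCyclicOp_pow
    {hS : Function.Bijective (HopfAlgebra.antipode ℂ : H →ₗ[ℂ] H)}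
    {n : ℕ} {f : Functional H B n} (hf : f ∈ invariantCochains hS n) (k : ℕ) :
    cyclicNorm n ((signedCyclicOp n ^ k) f) = cyclicNorm n f := by
  induction k with
  | zero => rfl
  | succ k ih =>
    rw [pow_succ', Module.End.mul_apply, cyclicNorm_signedCyclicOp (signedCyclicOp_pow_mem k hf), ih]

theorem signedCyclicOp_pow_cyclicNorm
    {hS : Function.Bijective (HopfAlgebra.antipode ℂ : H →ₗ[ℂ] H)}
    {n : ℕ} {f : Functional H B n} (hf : f ∈ invariantCochains hS n) (k : ℕ) :
    (signedCyclicOp n ^ k) (cyclicNorm n f) = cyclicNorm n f := by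
  induction k with
  | zero => rfl
  | succ k ih => rw [pow_succ', Module.End.mul_apply, ih, signedCyclicOp_cyclicNorm hf]

theorem signedCyclicOp_pow_coface {n : ℕ} (i : ℕ) (hi : i < n + 2) (f : Functional H B n) :
    (-1 : ℂ) ^ i • (signedCyclicOp (n + 1) ^ i) (coface n ⟨i, hi⟩ f) =
      coface n 0 ((signedCyclicOp n ^ i) f) := by
  induction i generalizing f with
  | zero => simp
  | succ i ih =>
    have h := signedCyclicOp_coface_succ ⟨i, by omega⟩ f
    rw [pow_succ (signedCyclicOp (n + 1)), Module.End.mul_apply]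
    rw [show (⟨i + 1, hi⟩ : Fin (n + 2)) = Fin.succ ⟨i, by omega⟩ from rfl, h, map_neg,
      pow_succ (-1 : ℂ), mul_neg_one, smul_neg, neg_smul, neg_neg]
    rw [pow_succ (signedCyclicOp n), Module.End.mul_apply, ← ih (by omega)]
    rfl

theorem cyclicNorm_coface {hS : Function.Bijective (HopfAlgebra.antipode ℂ : H →ₗ[ℂ] H)}
    {n : ℕ} {f : Functional H B n} (hf : f ∈ invariantCochains hS n) (i : Fin (n + 2)) :
    (-1 : ℂ) ^ (i : ℕ) • cyclicNorm (n + 1) (coface n i f) =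
      cyclicNorm (n + 1) (coface n 0 ((signedCyclicOp n ^ (i : ℕ)) f)) := by
  rw [← signedCyclicOp_pow_coface i i.2, map_smul, cyclicNorm_signedCyclicOp_pow (coface_mem _ hf)]

/-- Both sides equal N d₀ N f: each signed coface is a power of λ applied to d₀ up to powers of λ
inside, and N absorbs powers of λ on either side. -/
theorem cyclicNorm_hochschild' {hS : Function.Bijective (HopfAlgebra.antipode ℂ : H →ₗ[ℂ] H)}
    {n : ℕ} {f : Functional H B n} (hf : f ∈ invariantCochains hS n) :
    cyclicNorm (n + 1) (hochschild' n f) = hochschild n (cyclicNorm n f) := by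
  have h1 : cyclicNorm (n + 1) (hochschild' n f) =
      cyclicNorm (n + 1) (coface n 0 (cyclicNorm n f)) := by
    have h : cyclicNorm n f = ∑ i : Fin (n + 1), (signedCyclicOp n ^ (i : ℕ)) f := by
      rw [cyclicNorm, LinearMap.sum_apply, Finset.sum_range]
    rw [hochschild'_apply, h]
    simp only [map_sum, map_smul]
    exact Finset.sum_congr rfl fun i _ => cyclicNorm_coface hf i.castSucc
  -- Since λ ^ (n + 2) = 1 in degree n + 1, the power of λ can be moved to the other side. The
  -- exponents run from 1 to n + 2, which gives N after one further λ is absorbed.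
  have h2 : ∀ i : Fin (n + 2), (-1 : ℂ) ^ (i : ℕ) • coface n i (cyclicNorm n f) =
      (signedCyclicOp (n + 1) ^ (n + 2 - i : ℕ)) (coface n 0 (cyclicNorm n f)) := by
    intro i
    have h3 := signedCyclicOp_pow_coface i i.2 (cyclicNorm n f)
    rw [signedCyclicOp_pow_cyclicNorm hf] at h3
    have hi := i.2
    rw [← h3, map_smul, ← Module.End.mul_apply, ← pow_add, Nat.sub_add_cancel (by omega),
      signedCyclicOp_pow_succ (coface_mem i (cyclicNorm_mem hf))]
  rw [h1, hochschild_apply, Finset.sum_congr rfl fun i _ => h2 i]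
  rw [← cyclicNorm_signedCyclicOp (coface_mem 0 (cyclicNorm_mem hf)), cyclicNorm,
    LinearMap.sum_apply, Finset.sum_range]
  refine Fintype.sum_equiv Fin.revPerm _ _ fun i => ?_
  rw [← Module.End.mul_apply, ← pow_succ]
  congr 2
  simp only [Fin.revPerm_apply, Fin.val_rev]
  omega

theorem vertical_vertical (p : ℕ) {n : ℕ} (f : Functional H B n) :
    vertical p (n + 1) (vertical p n f) = 0 := by
  unfold vertical
  split_ifs
  · exact hochschild_hochschild f
  · simp [hochschild'_hochschild']

theorem vertical_mem {hS : Function.Bijective (HopfAlgebra.antipode ℂ : H →ₗ[ℂ] H)} (p : ℕ) {n : ℕ}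
    {f : Functional H B n} (hf : f ∈ invariantCochains hS n) :
    vertical p n f ∈ invariantCochains hS (n + 1) := by
  unfold vertical
  split_ifs
  · exact hochschild_mem hf
  · exact Submodule.neg_mem _ (hochschild'_mem hf)

theorem vertical_horizontal {hS : Function.Bijective (HopfAlgebra.antipode ℂ : H →ₗ[ℂ] H)} (p : ℕ)
    {n : ℕ} {f : Functional H B n} (hf : f ∈ invariantCochains hS n) :
    vertical (p + 1) n (horizontal p n f) = -horizontal p (n + 1) (vertical p n f) := by
  unfold vertical horizontal
  by_cases hp : Even p
  · have hp' : ¬ Even (p + 1) := by simpa [Nat.even_add_one] using hp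
    simp only [hp, hp', if_true, if_false, LinearMap.neg_apply, LinearMap.sub_apply,
      LinearMap.id_apply, signedCyclicOp_hochschild, map_sub]
    abel
  · have hp' : Even (p + 1) := by simpa [Nat.even_add_one] using hp
    simp only [hp, hp', if_true, if_false, LinearMap.neg_apply, map_neg, neg_neg,
      cyclicNorm_hochschild' hf]

/-- A contracting homotopy of the rows of the bicomplex. -/
noncomputable def rowContraction (p n : ℕ) : Functional H B n →ₗ[ℂ] Functional H B n :=
  ((n + 1 : ℕ) : ℂ)⁻¹ • if Even p then ∑ i ∈ Finset.range (n + 1), ∑ k ∈ Finset.range i,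
    signedCyclicOp n ^ k else LinearMap.id

theorem rowContraction_mem {hS : Function.Bijective (HopfAlgebra.antipode ℂ : H →ₗ[ℂ] H)} (p : ℕ)
    {n : ℕ} {f : Functional H B n} (hf : f ∈ invariantCochains hS n) :
    rowContraction p n f ∈ invariantCochains hS n := by
  refine Submodule.smul_mem _ _ ?_
  split_ifs
  · simp only [LinearMap.sum_apply]
    exact Submodule.sum_mem _ fun i _ => Submodule.sum_mem _ fun k _ => signedCyclicOp_pow_mem k hf
  · exact hf

theorem signedCyclicOp_pow_eq_self {n : ℕ} {f : Functional H B n} (hf : signedCyclicOp n f = f)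
    (k : ℕ) : (signedCyclicOp n ^ k) f = f := by
  induction k with
  | zero => rfl
  | succ k ih => rw [pow_succ', Module.End.mul_apply, ih, hf]

/-- For even p, each summand gives (1 - λ)(1 + ⋯ + λⁱ⁻¹) f = f - λⁱ f, and the average over i is f
because Nf = 0. For odd p, λf = f yields Nf = (n + 1) f. -/
theorem horizontal_rowContraction (p : ℕ) {n : ℕ} {f : Functional H B n}
    (hf : horizontal (p + 1) n f = 0) : horizontal p n (rowContraction p n f) = f := by
  have h0 : ((n + 1 : ℕ) : ℂ) ≠ 0 := Nat.cast_ne_zero.2 n.succ_ne_zero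
  unfold horizontal at hf ⊢
  by_cases hp : Even p
  · have hp' : ¬ Even (p + 1) := by simpa [Nat.even_add_one] using hp
    simp only [hp, hp', if_true, if_false] at hf ⊢
    have h1 : ∀ i : ℕ, (∑ k ∈ Finset.range i, signedCyclicOp n ^ k) f -
        signedCyclicOp n ((∑ k ∈ Finset.range i, signedCyclicOp n ^ k) f) =
        f - (signedCyclicOp n ^ i) f := fun i =>
      LinearMap.congr_fun (mul_neg_geom_sum (R := Module.End ℂ (Functional H B n))
        (signedCyclicOp n) i) f
    rw [cyclicNorm, LinearMap.sum_apply] at hf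
    rw [rowContraction, if_pos hp, LinearMap.sub_apply, LinearMap.id_apply, LinearMap.smul_apply,
      map_smul, ← smul_sub, LinearMap.sum_apply, map_sum, ← Finset.sum_sub_distrib,
      Finset.sum_congr rfl fun i _ => h1 i, Finset.sum_sub_distrib, hf, sub_zero, Finset.sum_const,
      Finset.card_range, ← Nat.cast_smul_eq_nsmul ℂ, smul_smul, inv_mul_cancel₀ h0, one_smul]
  · have hp' : Even (p + 1) := by simpa [Nat.even_add_one] using hp
    simp only [hp, hp', if_true, if_false, LinearMap.sub_apply, LinearMap.id_apply] at hf ⊢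
    rw [rowContraction, if_neg hp, LinearMap.smul_apply, map_smul, LinearMap.id_apply, cyclicNorm,
      LinearMap.sum_apply, Finset.sum_congr rfl fun i _ =>
        signedCyclicOp_pow_eq_self (sub_eq_zero.1 hf).symm i,
      Finset.sum_const, Finset.card_range, ← Nat.cast_smul_eq_nsmul ℂ, smul_smul,
      inv_mul_cancel₀ h0, one_smul]

end Differentials

/-! ### The cyclic homotopy between the identity and conjugation. -/

section Homotopy

variable {H B : Type*} [Ring H] [HopfAlgebra ℂ H] [Ring B] [Algebra ℂ B] [RightModuleAlgebra H B]

variable {u : Bˣ}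

/-- The homotopy between the identity and conjugation with `u`. -/
noncomputable def conjHomotopy (u : Bˣ) (n : ℕ) : Functional H B (n + 1) →ₗ[ℂ] Functional H B n :=
  ∑ j : Fin (n + 1), (-1 : ℂ) ^ (j : ℕ) • insertOne j.succ ∘ₗ gapOp u j.castSucc

theorem conjHomotopy_apply {n : ℕ} (f : Functional H B (n + 1)) :
    conjHomotopy u n f =
      ∑ j : Fin (n + 1), (-1 : ℂ) ^ (j : ℕ) • insertOne j.succ (gapOp u j.castSucc f) := by
  simp [conjHomotopy]

theorem conjHomotopy_mem {hS : Function.Bijective (HopfAlgebra.antipode ℂ : H →ₗ[ℂ] H)} {n : ℕ}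
    (hu : IsInvariant H (u : B)) {f : Functional H B (n + 1)}
    (hf : f ∈ invariantCochains hS (n + 1)) : conjHomotopy u n f ∈ invariantCochains hS n := by
  rw [conjHomotopy_apply]
  exact Submodule.sum_mem _ fun j _ =>
    Submodule.smul_mem _ _ (insertOne_mem _ (gapOp_mem hu _ hf))

/-- The terms i = j vanish, because dⱼ does not see gap j. In the terms i = j + 1 the inserted 1
undoes the coface, leaving minus the sum of all gap operators. The other terms are kept in the form
that cancels against bh. -/
theorem conjHomotopy_hochschild (hu : IsInvariant H (u : B)) {n : ℕ} (f : Functional H B n) :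
    conjHomotopy u n (hochschild n f) =
      f - pullback H ((Ad u : B ≃ₐ[ℂ] B) : B →ₐ[ℂ] B) n f -
      ∑ i : Fin (n + 1), ∑ j : Fin n, (-1 : ℂ) ^ (i + j : ℕ) • if i ≤ j.castSucc then
        insertOne j.succ.succ (gapOp u j.succ.castSucc (coface n i.castSucc f))
        else insertOne j.succ.castSucc (gapOp u j.castSucc.castSucc (coface n i.succ f)) := by
  let G : Fin (n + 2) → Fin (n + 1) → Functional H B n := fun i j =>
    (-1 : ℂ) ^ (i + j : ℕ) • insertOne j.succ (gapOp u j.castSucc (coface n i f))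
  have h1 : conjHomotopy u n (hochschild n f) = ∑ i, ∑ j, G i j := by
    rw [hochschild_apply, map_sum]
    simp only [map_smul, conjHomotopy_apply, Finset.smul_sum, smul_smul, ← pow_add]
    rfl
  have h2 : ∑ j : Fin (n + 1), G j.castSucc j = 0 :=
    Finset.sum_eq_zero fun j _ => by simp [G, gapOp_coface_self hu]
  have h3 : ∑ j : Fin (n + 1), G j.succ j =
      f - pullback H ((Ad u : B ≃ₐ[ℂ] B) : B →ₐ[ℂ] B) n f := by
    rw [← neg_sub (pullback H _ n f), ← sum_gapOp, ← Finset.sum_neg_distrib]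
    refine Finset.sum_congr rfl fun j _ => ?_
    -- Gap j lies before the gap j + 1 forgotten by the coface, hence keeps its number.
    have h4 := gapOp_coface hu j.succ j f
    rw [Fin.succAbove_succ_self] at h4
    simp only [G, h4, insertOne_coface_self, Fin.val_succ]
    rw [show (j + 1 + j : ℕ) = 2 * j + 1 by ring, pow_succ, pow_mul, neg_one_sq, one_pow, one_mul,
      neg_smul_functional, one_smul]
  rw [h1, sum_eq_of_eq_castSucc, h2, h3, zero_add, eq_sub_iff_add_eq, add_assoc, add_eq_left,
    ← Finset.sum_add_distrib]
  refine Finset.sum_eq_zero fun i _ => ?_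
  rw [← Finset.sum_add_distrib]
  refine Finset.sum_eq_zero fun j _ => ?_
  split_ifs
  · simp only [G, Fin.val_castSucc, Fin.val_succ]
    rw [← add_assoc, pow_succ, mul_neg_one, neg_smul_functional, neg_add_cancel]
  · simp only [G, Fin.val_castSucc, Fin.val_succ]
    rw [add_right_comm, pow_succ, mul_neg_one, neg_smul_functional, Fin.succ_castSucc, neg_add_cancel]

theorem hochschild_conjHomotopy (hu : IsInvariant H (u : B)) {n : ℕ}
    (f : Functional H B (n + 1)) :
    hochschild n (conjHomotopy u n f) =
      ∑ i : Fin (n + 2), ∑ j : Fin (n + 1), (-1 : ℂ) ^ (i + j : ℕ) • if i ≤ j.castSucc then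
        insertOne j.succ.succ (gapOp u j.succ.castSucc (coface (n + 1) i.castSucc f))
        else insertOne j.succ.castSucc (gapOp u j.castSucc.castSucc (coface (n + 1) i.succ f)) := by
  rw [hochschild_apply]
  refine Finset.sum_congr rfl fun i _ => ?_
  rw [conjHomotopy_apply, map_sum, Finset.smul_sum]
  refine Finset.sum_congr rfl fun j _ => ?_
  rw [map_smul, smul_smul, ← pow_add]
  congr 1
  split_ifs with h
  · rw [coface_insertOne_of_le h, ← gapOp_coface hu i.castSucc,
      Fin.succAbove_of_le_castSucc _ _ (Fin.castSucc_le_castSucc_iff.2 h), Fin.succ_castSucc]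
  · rw [coface_insertOne_of_lt (not_le.1 h), ← gapOp_coface hu i.succ,
      Fin.succAbove_of_castSucc_lt _ _ (Fin.castSucc_lt_succ_iff.2 (not_le.1 h).le)]

theorem conjHomotopy_zero (hu : IsInvariant H (u : B)) (f : Functional H B 0) :
    conjHomotopy u 0 (hochschild 0 f) = f - pullback H ((Ad u : B ≃ₐ[ℂ] B) : B →ₐ[ℂ] B) 0 f := by
  rw [conjHomotopy_hochschild hu]
  simp

theorem conjHomotopy_succ (hu : IsInvariant H (u : B)) {n : ℕ} (f : Functional H B (n + 1)) :
    hochschild n (conjHomotopy u n f) + conjHomotopy u (n + 1) (hochschild (n + 1) f) =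
      f - pullback H ((Ad u : B ≃ₐ[ℂ] B) : B →ₐ[ℂ] B) (n + 1) f := by
  rw [conjHomotopy_hochschild hu, hochschild_conjHomotopy hu]
  abel

/-- On a cyclic cochain, t carries the summand for gap j + 1 to the summand for gap j, with the sign
absorbed by λ; only the summand for gap 0 needs a separate argument. -/
theorem signedCyclicOp_conjHomotopy (hu : IsInvariant H (u : B)) {n : ℕ}
    {f : Functional H B (n + 1)} (hf : signedCyclicOp (n + 1) f = f) :
    signedCyclicOp n (conjHomotopy u n f) = conjHomotopy u n f := by
  have ht : cyclicOp (n + 1) f = (-1 : ℂ) ^ (n + 1) • f := by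
    rw [signedCyclicOp_apply] at hf
    nth_rewrite 2 [← hf]
    rw [smul_smul, ← pow_add, Even.neg_one_pow ⟨n + 1, rfl⟩, one_smul]
  have hD : ∀ j : Fin (n + 2), cyclicOp (n + 1) (gapOp u (j + 1) f) =
      (-1 : ℂ) ^ (n + 1) • gapOp u j f := fun j => by
    rw [cyclicOp_gapOp hu, ht, map_smul]
  rw [signedCyclicOp_apply, conjHomotopy_apply, map_sum]
  simp only [map_smul, cyclicOp_insertOne_succ]
  rw [Fin.sum_univ_succ, Fin.sum_univ_castSucc, smul_add, Finset.smul_sum]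
  refine (add_comm _ _).trans ?_
  congr 1
  · refine Finset.sum_congr rfl fun k _ => ?_
    have h := hD k.castSucc.castSucc
    rw [Fin.coeSucc_eq_succ, Fin.succ_castSucc] at h
    rw [h, map_smul, smul_smul, smul_smul, ← pow_add, ← pow_add, Fin.succ_castSucc, Fin.val_succ,
      Fin.val_castSucc, show n + (k + 1) + (n + 1) = k + ((n + 1) + (n + 1)) by ring, pow_add,
      Even.neg_one_pow ⟨n + 1, rfl⟩, mul_one]
  · have h0 := hD (Fin.last (n + 1))
    have h1 := hD (Fin.last n).castSucc
    rw [Fin.last_add_one] at h0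
    rw [Fin.coeSucc_eq_succ, Fin.succ_last] at h1
    have h2 : insertOne (Fin.castSucc 0) (cyclicOp (n + 1) (gapOp u (Fin.castSucc 0) f)) =
        insertOne (Fin.last n).succ (gapOp u (Fin.last n).castSucc f) := by
      change insertOne 0 (cyclicOp (n + 1) (gapOp u 0 f)) = _
      rw [← insertOne_last_cyclicOp, h0, map_smul, h1, smul_smul, ← pow_add,
        Even.neg_one_pow ⟨n + 1, rfl⟩, one_smul, Fin.succ_last]
    rw [h2]
    simp

end Homotopy

/-! ### Reduction of total cocycles to cyclic cocycles. -/

section TotalComplex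

variable {H B : Type*} [Ring H] [HopfAlgebra ℂ H] [Ring B] [Algebra ℂ B] [RightModuleAlgebra H B]

/-- The entry of a family in row `q`, extended by zero to all natural numbers `q`. -/
def row {n : ℕ} (q : ℕ) (z : TotalFunctional H B n) : Functional H B q :=
  if h : q < n + 1 then entry ⟨q, h⟩ z else 0

theorem row_of_lt {n q : ℕ} (h : q < n + 1) (z : TotalFunctional H B n) :
    row q z = entry ⟨q, h⟩ z := dif_pos h

theorem row_of_le {n q : ℕ} (h : n + 1 ≤ q) (z : TotalFunctional H B n) : row q z = 0 :=
  dif_neg (not_lt.2 h)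

theorem totalFunctional_ext {n : ℕ} {z z' : TotalFunctional H B n}
    (h : ∀ q, q < n + 1 → row q z = row q z') : z = z' := by
  funext q
  have h' := h q q.2
  rw [row_of_lt q.2, row_of_lt q.2] at h'
  exact h'

theorem row_sub {n : ℕ} (q : ℕ) (z z' : TotalFunctional H B n) :
    row q (z - z') = row q z - row q z' := by
  unfold row
  split_ifs
  · exact map_sub _ _ _
  · rw [sub_zero]

theorem row_zero {n : ℕ} (q : ℕ) : row q (0 : TotalFunctional H B n) = 0 := by
  unfold row
  split_ifs
  · exact map_zero _
  · rfl

theorem row_totalPullback (φ : B →ₐ[ℂ] B) {n : ℕ} (q : ℕ) (z : TotalFunctional H B n) :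
    row q (totalPullback H φ n z) = pullback H φ q (row q z) := by
  unfold row
  split_ifs
  · rfl
  · rw [map_zero]

theorem mem_totalCochains_iff {hS : Function.Bijective (HopfAlgebra.antipode ℂ : H →ₗ[ℂ] H)}
    {n : ℕ} {z : TotalFunctional H B n} :
    z ∈ totalCochains hS n ↔ ∀ q, row q z ∈ invariantCochains hS q := by
  simp only [totalCochains, Submodule.mem_iInf, Submodule.mem_comap]
  constructor
  · intro h q
    unfold row
    split_ifs with hq
    · exact h ⟨q, hq⟩
    · exact Submodule.zero_mem _
  · intro h q
    have h' := h q
    rw [row_of_lt q.2] at h'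
    exact h'

theorem row_totalD_zero {n : ℕ} (z : TotalFunctional H B n) :
    row 0 (totalD n z) = horizontal n 0 (row 0 z) := by
  rw [row_of_lt (Nat.succ_pos _), row_of_lt (Nat.succ_pos _)]
  exact zero_add _

/-- For q = n the subtraction in the column index truncates, which is harmless: row n + 1 of a
family of degree n is zero. -/
theorem row_totalD_succ {n q : ℕ} (hq : q < n + 1) (z : TotalFunctional H B n) :
    row (q + 1) (totalD n z) =
      vertical (n - q) q (row q z) + horizontal (n - (q + 1)) (q + 1) (row (q + 1) z) := by
  rw [row_of_lt (Nat.succ_lt_succ hq), row_of_lt hq]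
  refine congrArg (vertical (n - q) q (entry ⟨q, hq⟩ z) + ·) ?_
  unfold row
  change (dite (q + 1 < n + 1) _ _ : _ →ₗ[ℂ] _) z = _
  split_ifs with h
  · rfl
  · rw [map_zero]; rfl

/-- The family with given entries. -/
def ofRows (n : ℕ) (F : (q : ℕ) → Functional H B q) : TotalFunctional H B n := fun q => F q

theorem row_ofRows {n q : ℕ} (hq : q < n + 1) (F : (q : ℕ) → Functional H B q) :
    row q (ofRows n F) = F q := row_of_lt hq _

theorem ofRows_mem {hS : Function.Bijective (HopfAlgebra.antipode ℂ : H →ₗ[ℂ] H)} (n : ℕ)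
    {F : (q : ℕ) → Functional H B q} (hF : ∀ q, F q ∈ invariantCochains hS q) :
    ofRows n F ∈ totalCochains hS n := by
  simp only [totalCochains, Submodule.mem_iInf, Submodule.mem_comap]
  exact fun q => hF q

/-- What is left of the entries of a family of degree `n + 1` when the rows below have been
removed successively by means of the contractions of the rows. -/
noncomputable def residue {n : ℕ} (z : TotalFunctional H B (n + 1)) : (q : ℕ) → Functional H B q
  | 0 => row 0 z
  | q + 1 => row (q + 1) z - vertical (n - q) q (rowContraction (n - q) q (residue z q))

theorem residue_mem {hS : Function.Bijective (HopfAlgebra.antipode ℂ : H →ₗ[ℂ] H)} {n : ℕ}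
    {z : TotalFunctional H B (n + 1)} (hz : z ∈ totalCochains hS (n + 1)) (q : ℕ) :
    residue z q ∈ invariantCochains hS q := by
  rw [mem_totalCochains_iff] at hz
  induction q with
  | zero => exact hz 0
  | succ q ih =>
    exact Submodule.sub_mem _ (hz (q + 1)) (vertical_mem _ (rowContraction_mem _ ih))

theorem vertical_residue {n : ℕ} (z : TotalFunctional H B (n + 1)) (q : ℕ) :
    vertical (n + 1 - q) q (residue z q) = vertical (n + 1 - q) q (row q z) := by
  cases q with
  | zero => rfl
  | succ q => rw [residue, map_sub, Nat.add_sub_add_right, vertical_vertical, sub_zero]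

/-- The cocycle equation and the anticommutation of the differentials carry this from each row to
the next. It is the condition under which the next contraction applies. -/
theorem horizontal_residue {hS : Function.Bijective (HopfAlgebra.antipode ℂ : H →ₗ[ℂ] H)} {n : ℕ}
    {z : TotalFunctional H B (n + 1)} (hz : z ∈ totalCochains hS (n + 1))
    (hd : totalD (n + 1) z = 0) {q : ℕ} (hq : q ≤ n + 1) :
    horizontal (n + 1 - q) q (residue z q) = 0 := by
  induction q with
  | zero => rw [residue, Nat.sub_zero, ← row_totalD_zero, hd, row_zero]
  | succ q ih =>
    have hq' : q ≤ n := Nat.le_of_succ_le_succ hq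
    have hp : n + 1 - q = n - q + 1 := Nat.succ_sub hq'
    have h1 := row_totalD_succ (Nat.lt_of_succ_le (Nat.le_succ_of_le hq)) z
    rw [hd, row_zero, ← vertical_residue, hp, Nat.add_sub_add_right] at h1
    have h2 := ih (Nat.le_succ_of_le hq')
    rw [hp] at h2
    have h3 := vertical_horizontal (n - q) (rowContraction_mem (n - q) (residue_mem hz q))
    rw [horizontal_rowContraction _ h2] at h3
    rw [residue, Nat.add_sub_add_right, map_sub, sub_eq_add_neg, ← h3]
    exact (add_comm _ _).trans h1.symm

/-- In positive degree z = D(w) + f with f a cyclic cocycle in the top row, and Ad*f - f = -b(g) for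
the cyclic cochain g = hf. Hence Ad*z - z = D(Ad*w - w - g). -/
theorem totalPullback_sub_mem {hS : Function.Bijective (HopfAlgebra.antipode ℂ : H →ₗ[ℂ] H)}
    {u : Bˣ} (hu : IsInvariant H (u : B)) {n : ℕ} {z : TotalFunctional H B n}
    (hz : z ∈ totalCocycles hS n) :
    totalPullback H ((Ad u : B ≃ₐ[ℂ] B) : B →ₐ[ℂ] B) n z - z ∈ totalCoboundaries hS n := by
  have hd : totalD n z = 0 := hz.2
  have hc : z ∈ totalCochains hS n := hz.1
  cases n with
  | zero =>
    -- In degree 0 there are no coboundaries; bz = 0 and the homotopy formula give Ad*z = z itself.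
    have h1 := row_totalD_succ (Nat.succ_pos 0) z
    rw [hd, row_zero, row_of_le le_rfl, map_zero, add_zero] at h1
    have h2 : hochschild 0 (row 0 z) = 0 := h1.symm
    have h3 := conjHomotopy_zero hu (row 0 z)
    rw [h2, map_zero] at h3
    rw [totalCoboundaries, Submodule.mem_bot]
    refine totalFunctional_ext fun q hq => ?_
    obtain rfl : q = 0 := by omega
    rw [row_sub, row_totalPullback, row_zero, ← neg_sub, ← h3, neg_zero]
  | succ n =>
    set φ : B →ₐ[ℂ] B := ((Ad u : B ≃ₐ[ℂ] B) : B →ₐ[ℂ] B) with hφ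
    have he : IsEquivariant H φ := Ad_isEquivariant hu
    set f := residue z (n + 1) with hf
    have hfm : f ∈ invariantCochains hS (n + 1) := residue_mem hc _
    have hfc : signedCyclicOp (n + 1) f = f := by
      have h := horizontal_residue hc hd le_rfl
      rw [Nat.sub_self] at h
      exact (sub_eq_zero.1 h).symm
    have hfb : hochschild (n + 1) f = 0 := by
      have h := row_totalD_succ (Nat.lt_succ_self (n + 1)) z
      rw [hd, row_zero, row_of_le le_rfl, map_zero, add_zero, ← vertical_residue,
        Nat.sub_self] at h
      exact h.symm
    set w : (q : ℕ) → Functional H B q := fun q => rowContraction (n - q) q (residue z q) with hw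
    have hwm : ∀ q, w q ∈ invariantCochains hS q := fun q =>
      rowContraction_mem _ (residue_mem hc q)
    have hwr : ∀ q, q ≤ n → horizontal (n - q) q (w q) = residue z q := fun q hq => by
      refine horizontal_rowContraction _ ?_
      have h := horizontal_residue hc hd (Nat.le_succ_of_le hq)
      rwa [show n + 1 - q = n - q + 1 from Nat.succ_sub hq] at h
    have hgc : horizontal 0 n (conjHomotopy u n f) = 0 :=
      sub_eq_zero.2 (signedCyclicOp_conjHomotopy hu hfc).symm
    have hgb := conjHomotopy_succ hu f
    rw [hfb, map_zero, add_zero] at hgb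
    have hpv := fun (p m : ℕ) (f : Functional H B m) =>
      LinearMap.congr_fun (pullback_vertical he p m) f
    have hph := fun (p m : ℕ) (f : Functional H B m) =>
      LinearMap.congr_fun (pullback_horizontal he p m) f
    simp only [LinearMap.comp_apply] at hpv hph
    set g := conjHomotopy u n f with hg
    -- The correction g lies in row n, column 0. There 1 - λ kills it, so it changes D only in row n
    -- + 1.
    set v : (q : ℕ) → Functional H B q :=
      Function.update (fun q => pullback H φ q (w q) - w q) n (pullback H φ n (w n) - w n - g)
      with hv
    have hvn : v n = pullback H φ n (w n) - w n - g := Function.update_self _ _ _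
    have hvq : ∀ q, q ≠ n → v q = pullback H φ q (w q) - w q := fun q hq =>
      Function.update_of_ne hq _ _
    have hvm : ∀ q, v q ∈ invariantCochains hS q := fun q => by
      have h := Submodule.sub_mem _ (pullback_mem he hS (hwm q)) (hwm q)
      rcases eq_or_ne q n with rfl | hq
      · rw [hvn]
        exact Submodule.sub_mem _ h (conjHomotopy_mem hu hfm)
      · rw [hvq q hq]
        exact h
    have hvh : ∀ q, q ≤ n →
        horizontal (n - q) q (v q) = pullback H φ q (residue z q) - residue z q := fun q hq => by
      have h : horizontal (n - q) q (pullback H φ q (w q) - w q) =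
          pullback H φ q (residue z q) - residue z q := by
        rw [map_sub, ← hph, hwr q hq]
      rcases eq_or_ne q n with rfl | hq'
      · rw [hvn, map_sub, h, Nat.sub_self, hgc, sub_zero]
      · rw [hvq q hq', h]
    have hres : ∀ q, residue z (q + 1) = row (q + 1) z - vertical (n - q) q (w q) := fun q => rfl
    refine ⟨ofRows n v, ofRows_mem n hvm, totalFunctional_ext fun q hq => ?_⟩
    rw [row_sub, row_totalPullback]
    cases q with
    | zero =>
      rw [row_totalD_zero, row_ofRows (Nat.succ_pos n)]
      exact hvh 0 (Nat.zero_le n)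
    | succ q =>
      have hq' : q < n + 1 := Nat.lt_of_succ_lt_succ hq
      rw [row_totalD_succ hq', row_ofRows hq']
      rcases eq_or_ne q n with rfl | hqn
      · have hgv : vertical 0 q g = f - pullback H φ (q + 1) f := hgb
        have hfr : f = row (q + 1) z - vertical 0 q (w q) := by rw [hf, hres, Nat.sub_self]
        rw [row_of_le le_rfl, map_zero, add_zero, hvn, Nat.sub_self, map_sub, hgv, map_sub, ← hpv,
          hfr, map_sub]
        abel
      · have hqn' : q + 1 ≤ n := by omega
        rw [row_ofRows (Nat.lt_succ_of_le hqn'), hvh _ hqn', hvq q hqn, map_sub, ← hpv, hres,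
          map_sub]
        abel

end TotalComplex

end EquivariantCyclic

theorem corollary2p5 {H B : Type*} [Ring H] [HopfAlgebra ℂ H]
    (hS : Function.Bijective (HopfAlgebra.antipode ℂ : H →ₗ[ℂ] H))
    [Ring B] [Algebra ℂ B] [EquivariantCyclic.RightModuleAlgebra H B]
    (b : Bˣ) (hb : EquivariantCyclic.IsInvariant H (b : B)) (n : ℕ) :
    EquivariantCyclic.HC.map hS ((EquivariantCyclic.Ad b : B ≃ₐ[ℂ] B) : B →ₐ[ℂ] B)
      (EquivariantCyclic.Ad_isEquivariant hb) n = LinearMap.id := by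
  refine LinearMap.ext fun x => ?_
  obtain ⟨z, rfl⟩ := Submodule.mkQ_surjective _ x
  exact (Submodule.Quotient.eq _).2 (EquivariantCyclic.totalPullback_sub_mem hb z.2)
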